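/- Let $a>b>0$, $c^2=a^2-b^2$, and let $\mathcal{E}$ be the ellipse $x^2/a^2+y^2/b^2=1$. Let $\mathcal{E}_\triangle$ be the locus of the centroids of all equilateral triangles inscribed in $\mathcal{E}$; it is the ellipse centered at the origin, with semiaxes $a_\triangle=\frac{a c^2}{a^2+3b^2}$ along the $x$-axis and $b_\triangle=\frac{b c^2}{3a^2+b^2}$ along the $y$-axis. For a point $C=[x_c,y_c]$ in the interior of $\mathcal{E}$, consider the Poncelet family of all triangles that are inscribed in $\mathcal{E}$ and have a given circle centered at $C$ as incircle. Such a circle with a nonempty family exists; fix any one. Let $X_{36}$ denote the inverse of the incenter of a triangle in its circumcircle (a point at infinity if the incenter is the circumcenter, i.e., if the triangle is equilateral), and let $\mathcal{L}_{36}$ be the locus of the finite points $X_{36}$ over the family. If $C$ does not lie on $\mathcal{E}_\triangle$, then $\mathcal{L}_{36}$ is a circle of positive radius. If $C$ lies on $\mathcal{E}_\triangle$ (which is contained in the interior of $\mathcal{E}$), then $\mathcal{L}_{36}$ degenerates to a line; precisely, it is the whole line \[ b^{2} x_c\, x + a^{2} y_c\, y = \frac{b^{2}\left(a^{4}+2a^{2}b^{2}+5b^{4}\right)x_c^{2}+a^{2}\left(5a^{4}+2a^{2}b^{2}+b^{4}\right)y_c^{2}}{c^4}.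 \] -/

import Mathlib

noncomputable section

namespace PonceletX36

/-- The Euclidean plane, with coordinates `p 0` and `p 1`. -/
abbrev Plane : Type := EuclideanSpace ℝ (Fin 2)

/-- The ellipse centered at the origin, with semiaxes `a` and `b` along the coordinate axes. -/
def axisEllipse (a b : ℝ) : Set Plane :=
  {p | (p 0 / a) ^ 2 + (p 1 / b) ^ 2 = 1}

/-- The open region bounded by `axisEllipse a b`. -/
def axisEllipseInterior (a b : ℝ) : Set Plane :=
  {p | (p 0 / a) ^ 2 + (p 1 / b) ^ 2 < 1}

/-- The locus of the centroids of all equilateral triangles inscribed in `axisEllipse a b`. -/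
def equilateralCentroidLocus (a b : ℝ) : Set Plane :=
  {P | ∃ T : Affine.Triangle ℝ Plane,
    (∀ i, T.points i ∈ axisEllipse a b) ∧ T.Equilateral ∧ T.centroid = P}

/-- The Poncelet triangles inscribed in `axisEllipse a b` and circumscribing the circle with
center `C` and radius `r`: the vertices lie on the ellipse, and the circle is the incircle. -/
def ponceletTriangles (a b : ℝ) (C : Plane) (r : ℝ) : Set (Affine.Triangle ℝ Plane) :=
  {T | (∀ i, T.points i ∈ axisEllipse a b) ∧ T.incenter = C ∧ T.inradius = r}

/-- The triangle center `X₃₆`: the inverse of the incenter in the circumcircle. It is a point of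
the plane only if the incenter differs from the circumcenter. -/
def X36 (T : Affine.Triangle ℝ Plane) : Plane :=
  EuclideanGeometry.inversion T.circumcenter T.circumradius T.incenter

/-- The locus of `X₃₆` over the Poncelet triangles. A triangle whose incenter is its circumcenter
is left out, because its `X₃₆` is at infinity. -/
def locusX36 (a b : ℝ) (C : Plane) (r : ℝ) : Set Plane :=
  {P | ∃ T ∈ ponceletTriangles a b C r, T.incenter ≠ T.circumcenter ∧ X36 T = P}

end PonceletX36

end

namespace PonceletX36

open ComplexConjugate

/-! ### Triples of unit complex numbers -/

/-! Take `C` as origin and the inradius as unit, and describe a triangle by its contact points `u`,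
`v`, `w` on the unit circle. The vertices are `2vw/(v+w)` and its analogues, and the unit circle is
the incircle exactly when `σ = u + v + w` has norm less than 1 (`exists_hasContact`,
`HasContact.incenter_eq`).

The three vertices lie on the ellipse iff `σ = s + m·uvw` and `|s|² = 1 + m² + k`, where `s`, `m`,
`k` depend only on the ellipse, `C` and `r` (`tangentConic_eq_zero_iff`, `pt_mem_axisEllipse_iff`).
The second equation is the closure condition. Once a family exists, every unit value of `uvw` occurs
(`exists_unit_triple`), so `σ` runs over the whole circle with center `s` and radius `m`.

The circumcenter is `2σ/(|σ|²-1)`, whence `X36` is `2σ/|σ|²`: the locus is the inverse of the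
`σ`-circle. It is a line iff that circle passes through 0, that is, iff `|s| = m`. But `σ = 0` means
that the triangle is equilateral with centroid `C`, so the exceptional centers form the centroid
locus. By the closure condition, `|s| = m` is independent of `r` and is the equation of the centroid
ellipse (`norm_shift_sq_eq_spread_sq_iff`, `mem_centroidEllipse_iff`). -/

lemma mul_conj_of_norm_one {u : ℂ} (hu : ‖u‖ = 1) : u * conj u = 1 := by
  rw [Complex.mul_conj, Complex.normSq_eq_norm_sq, hu]; norm_num

lemma ne_zero_of_norm_one {u : ℂ} (hu : ‖u‖ = 1) : u ≠ 0 := by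
  rintro rfl; simp at hu

lemma sum_ne_zero_of_norm_sum_lt {u v w : ℂ} (hu : ‖u‖ = 1) (h : ‖u + v + w‖ < 1) :
    v + w ≠ 0 := by
  intro h0
  rw [add_assoc, h0, add_zero, hu] at h
  exact lt_irrefl _ h

lemma ne_of_norm_sum_lt {u v w : ℂ} (hu : ‖u‖ = 1) (hv : ‖v‖ = 1) (h : ‖u + v + w‖ < 1) :
    v ≠ w := by
  rintro rfl
  have h1 : ‖(2 : ℂ) * v‖ = 2 := by simp [hv]
  have h2 : ‖(2 : ℂ) * v‖ ≤ ‖u + v + v‖ + ‖u‖ := by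
    have := norm_sub_le (u + v + v) u
    rwa [show u + v + v - u = 2 * v by ring] at this
  linarith

/-- The roots of a self-inversive cubic whose quadratic coefficient lies in the open unit disk
are on the unit circle. -/
lemma norm_eq_one_of_cubic_eq_zero {σ l z : ℂ} (hσ : ‖σ‖ < 1) (hl : ‖l‖ = 1)
    (h : z ^ 3 - σ * z ^ 2 + l * conj σ * z - l = 0) : ‖z‖ = 1 := by
  have h1 : ‖z‖ ^ 2 * ‖z - σ‖ = ‖1 - conj σ * z‖ := by
    have : z ^ 2 * (z - σ) = l * (1 - conj σ * z) := by linear_combination h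
    simpa [hl] using congrArg norm this
  have h2 : ‖1 - conj σ * z‖ ^ 2 - ‖z - σ‖ ^ 2 = (1 - ‖σ‖ ^ 2) * (1 - ‖z‖ ^ 2) := by
    simp only [← Complex.normSq_eq_norm_sq, Complex.normSq_apply, Complex.sub_re, Complex.sub_im,
      Complex.mul_re, Complex.mul_im, Complex.conj_re, Complex.conj_im, Complex.one_re,
      Complex.one_im]
    ring
  have hs : 0 < 1 - ‖σ‖ ^ 2 := by nlinarith [norm_nonneg σ]
  rw [← h1] at h2
  have hN := norm_nonneg z
  have ha := sq_nonneg ‖z - σ‖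
  have h3 : (‖z‖ ^ 4 - 1) * ‖z - σ‖ ^ 2 = (1 - ‖σ‖ ^ 2) * (1 - ‖z‖ ^ 2) := by
    linear_combination h2
  have h4 : (‖z‖ ^ 2 - 1) * ((‖z‖ ^ 2 + 1) * ‖z - σ‖ ^ 2 + (1 - ‖σ‖ ^ 2)) = 0 := by
    linear_combination h3
  rcases mul_eq_zero.1 h4 with h5 | h5
  · have : (‖z‖ - 1) * (‖z‖ + 1) = 0 := by linear_combination h5
    rcases mul_eq_zero.1 this with h6 | h6 <;> linarith
  · have : 0 ≤ (‖z‖ ^ 2 + 1) * ‖z - σ‖ ^ 2 := by positivity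
    linarith

/-- For unit numbers the second symmetric function must be `l * conj σ`, so the triple consists of
the roots of a self-inversive cubic. -/
lemma exists_unit_triple {σ l : ℂ} (hσ : ‖σ‖ < 1) (hl : ‖l‖ = 1) :
    ∃ u v w : ℂ, ‖u‖ = 1 ∧ ‖v‖ = 1 ∧ ‖w‖ = 1 ∧ u + v + w = σ ∧ u * v * w = l := by
  obtain ⟨u, hu⟩ : ∃ u : ℂ, u ^ 3 - σ * u ^ 2 + l * conj σ * u - l = 0 := by
    have hd : (Polynomial.X ^ 3 - Polynomial.C σ * Polynomial.X ^ 2 +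
        Polynomial.C (l * conj σ) * Polynomial.X - Polynomial.C l : Polynomial ℂ).degree = 3 := by
      compute_degree!
    obtain ⟨u, hu⟩ := IsAlgClosed.exists_root _ (hd.trans_ne (by norm_num))
    exact ⟨u, by simpa [Polynomial.IsRoot] using hu⟩
  have hu1 := norm_eq_one_of_cubic_eq_zero hσ hl hu
  have hu0 := ne_zero_of_norm_one hu1
  obtain ⟨d, hd⟩ := IsAlgClosed.exists_pow_nat_eq ((σ - u) ^ 2 - 4 * (l / u)) (n := 2) two_pos
  have hlu : l / u * u = l := div_mul_cancel₀ l hu0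
  set v := ((σ - u) + d) / 2 with hv
  set w := ((σ - u) - d) / 2 with hw
  have hsum : u + v + w = σ := by rw [hv, hw]; ring
  have hvw : v * w = l / u := by rw [hv, hw]; linear_combination (-1 / 4 : ℂ) * hd
  have hprod : u * v * w = l := by rw [mul_assoc, hvw, mul_comm, hlu]
  have hsnd : u * v + u * w + v * w = l * conj σ := by
    refine mul_right_cancel₀ hu0 ?_
    linear_combination hprod - hu + u ^ 2 * hsum
  refine ⟨u, v, w, hu1, ?_, ?_, hsum, hprod⟩
  · exact norm_eq_one_of_cubic_eq_zero hσ hl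
      (by linear_combination v ^ 2 * hsum - v * hsnd + hprod)
  · exact norm_eq_one_of_cubic_eq_zero hσ hl
      (by linear_combination w ^ 2 * hsum - w * hsnd + hprod)

lemma conj_sum_mul_prod {u v w : ℂ} (hu : ‖u‖ = 1) (hv : ‖v‖ = 1) (hw : ‖w‖ = 1) :
    u * v * w * conj (u + v + w) = u * v + u * w + v * w := by
  simp only [map_add]
  linear_combination v * w * mul_conj_of_norm_one hu + u * w * mul_conj_of_norm_one hv +
    u * v * mul_conj_of_norm_one hw

/-- In elementary symmetric functions, both sides are `e₁e₂ - e₃`, because `e₃ * conj e₁ = e₂` on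
the unit circle. -/
lemma norm_sum_sq_sub_one {u v w : ℂ} (hu : ‖u‖ = 1) (hv : ‖v‖ = 1) (hw : ‖w‖ = 1) :
    ((‖u + v + w‖ ^ 2 - 1 : ℝ) : ℂ) * (u * v * w) = (u + v) * (v + w) * (u + w) := by
  push_cast
  rw [← Complex.mul_conj']
  linear_combination (u + v + w) * conj_sum_mul_prod hu hv hw

/-- The condition for the intersection point `2 v w / (v + w)` of the tangents of the unit circle
at `v` and `w` to lie on a conic, in the normalization adapted to the incircle. -/
def tangentConic (s : ℂ) (m k : ℝ) (v w : ℂ) : ℂ :=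
  (v + w) ^ 2 - s * (v + w) - conj s * (v + w) * (v * w) + m + m * (v * w) ^ 2 + k * (v * w)

lemma tangentConic_eq_zero_iff {s : ℂ} {m k : ℝ} {u v w : ℂ} (hu : ‖u‖ = 1) (hv : ‖v‖ = 1)
    (hw : ‖w‖ = 1) (huv : u ≠ v) (huw : u ≠ w) (hvw : v ≠ w) :
    (tangentConic s m k v w = 0 ∧ tangentConic s m k u w = 0 ∧ tangentConic s m k u v = 0) ↔
      u + v + w = s + m * (u * v * w) ∧ ‖s‖ ^ 2 = 1 + m ^ 2 + k := by
  have hu0 := ne_zero_of_norm_one hu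
  have hv0 := ne_zero_of_norm_one hv
  have hw0 := ne_zero_of_norm_one hw
  have hc := conj_sum_mul_prod hu hv hw
  have hcl : ((‖s‖ ^ 2 = 1 + m ^ 2 + k) ↔ s * conj s = 1 + m ^ 2 + k) := by
    rw [Complex.mul_conj']; norm_cast
  have hl1 : u * v * w * conj (u * v * w) = 1 :=
    mul_conj_of_norm_one (by simp [hu, hv, hw])
  rw [hcl]
  unfold tangentConic
  constructor
  · rintro ⟨h1, h2, h3⟩
    set l := u * v * w with hl
    have hl0 : l ≠ 0 := by simp [hl, hu0, hv0, hw0]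
    set σ := u + v + w with hσ
    set τ := u * v + u * w + v * w with hτ
    -- Substituting `v + w = σ - u` and `v w = l / u` in `u²` times the condition, and reducing by
    -- the cubic with roots `u`, `v`, `w`, leaves a quadratic in `u` with symmetric coefficients. It
    -- has three distinct roots, hence vanishes; `A0 = 0` gives the formula for `σ` and `A1 = 0` the
    -- closure condition.
    obtain ⟨A2, hA2⟩ : ∃ A2, A2 = σ ^ 2 - s * σ + conj s * l + m - (τ - σ * (s - σ)) := ⟨_, rfl⟩
    obtain ⟨A1, hA1⟩ : ∃ A1, A1 = k * l - conj s * l * σ - (-l + τ * (s - σ)) := ⟨_, rfl⟩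
    obtain ⟨A0, hA0⟩ : ∃ A0, A0 = m * l ^ 2 + l * (s - σ) := ⟨_, rfl⟩
    have e1 : A2 * u ^ 2 + A1 * u + A0 = 0 := by
      rw [hA2, hA1, hA0, hτ, hl, hσ]; linear_combination u ^ 2 * h1
    have e2 : A2 * v ^ 2 + A1 * v + A0 = 0 := by
      rw [hA2, hA1, hA0, hτ, hl, hσ]; linear_combination v ^ 2 * h2
    have e3 : A2 * w ^ 2 + A1 * w + A0 = 0 := by
      rw [hA2, hA1, hA0, hτ, hl, hσ]; linear_combination w ^ 2 * h3
    have f1 : A2 * (u + v) + A1 = 0 :=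
      mul_left_cancel₀ (sub_ne_zero.2 huv) (by linear_combination e1 - e2)
    have f2 : A2 * (u + w) + A1 = 0 :=
      mul_left_cancel₀ (sub_ne_zero.2 huw) (by linear_combination e1 - e3)
    have g2 : A2 = 0 := mul_left_cancel₀ (sub_ne_zero.2 hvw) (by linear_combination f1 - f2)
    have g1 : A1 = 0 := by linear_combination f1 - (u + v) * g2
    have g0 : A0 = 0 := by linear_combination e1 - u ^ 2 * g2 - u * g1
    have hs : σ = s + m * l := mul_left_cancel₀ hl0 (by linear_combination -g0 + hA0)
    refine ⟨hs, ?_⟩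
    have hcs : l * conj s = τ - m := by
      have := congrArg (fun z => l * conj z) hs
      simp only [map_add, map_mul, Complex.conj_ofReal] at this
      rw [map_add, map_add] at hc
      simp only [hσ, map_add] at this
      linear_combination hc - this - m * hl1
    refine mul_left_cancel₀ hl0 ?_
    linear_combination (s - σ) * hcs - g1 + hA1 + m * hs
  · rintro ⟨hs, hk⟩
    have hcs : u * v * w * conj s = u * v + u * w + v * w - m := by
      have := congrArg (fun z => u * v * w * conj z) hs
      simp only [map_add, map_mul, Complex.conj_ofReal] at this hc hl1
      linear_combination hc - this - m * hl1
    refine ⟨mul_left_cancel₀ (pow_ne_zero 2 hu0) ?_, mul_left_cancel₀ (pow_ne_zero 2 hv0) ?_,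
      mul_left_cancel₀ (pow_ne_zero 2 hw0) ?_⟩
    · linear_combination (u ^ 2 + u * (s - (u + v + w))) * hcs - u * (u * v * w) * hk +
        (u * m - u * v * w) * hs
    · linear_combination (v ^ 2 + v * (s - (u + v + w))) * hcs - v * (u * v * w) * hk +
        (v * m - u * v * w) * hs
    · linear_combination (w ^ 2 + w * (s - (u + v + w))) * hcs - w * (u * v * w) * hk +
        (w * m - u * v * w) * hs

end PonceletX36

noncomputable section

namespace PonceletX36

open ComplexConjugate
open scoped RealInnerProductSpace

/-! ### A complex coordinate on the plane -/

/-- The point of the plane with complex coordinate `z`, for the origin `C` and the unit `r`. -/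
def pt (C : Plane) (r : ℝ) (z : ℂ) : Plane := !₂[C 0 + r * z.re, C 1 + r * z.im]

@[simp] lemma pt_apply_zero (C : Plane) (r : ℝ) (z : ℂ) : pt C r z 0 = C 0 + r * z.re := rfl

@[simp] lemma pt_apply_one (C : Plane) (r : ℝ) (z : ℂ) : pt C r z 1 = C 1 + r * z.im := rfl

lemma pt_zero (C : Plane) (r : ℝ) : pt C r 0 = C := by
  ext i; fin_cases i <;> simp

lemma pt_surjective (C : Plane) {r : ℝ} (hr : r ≠ 0) : Function.Surjective (pt C r) := by
  intro P
  refine ⟨⟨(P 0 - C 0) / r, (P 1 - C 1) / r⟩, ?_⟩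
  ext i
  fin_cases i <;> simp [mul_div_cancel₀ _ hr]

lemma dist_pt (C : Plane) {r : ℝ} (hr : 0 ≤ r) (z w : ℂ) :
    dist (pt C r z) (pt C r w) = r * ‖z - w‖ := by
  rw [EuclideanSpace.dist_eq, Real.sqrt_eq_iff_mul_self_eq (by positivity) (by positivity)]
  have := Complex.normSq_eq_norm_sq (z - w)
  rw [Complex.normSq_apply, Complex.sub_re, Complex.sub_im] at this
  simp only [Fin.sum_univ_two, Real.dist_eq, sq_abs, pt_apply_zero, pt_apply_one]
  linear_combination r ^ 2 * this

lemma pt_injective (C : Plane) {r : ℝ} (hr : 0 < r) : Function.Injective (pt C r) := by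
  intro z w h
  have := dist_pt C hr.le z w
  rw [h, dist_self] at this
  simpa [hr.ne', sub_eq_zero] using this.symm

lemma inner_pt_sub (C D : Plane) (r t : ℝ) (z z' w w' : ℂ) :
    ⟪pt C r z - pt C r z', pt D t w - pt D t w'⟫ = r * t * (conj (z - z') * (w - w')).re := by
  simp [PiLp.inner_apply, Fin.sum_univ_two]
  ring

lemma affineSpan_range_eq_top (T : Affine.Triangle ℝ Plane) :
    affineSpan ℝ (Set.range T.points) = ⊤ := by
  rw [T.independent.affineSpan_eq_top_iff_card_eq_finrank_add_one]
  simp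

/-! ### The incenter -/

/-- A criterion for a circle to be the incircle: the sides have outward unit normals `n i` and
support lines at distance `r` of the center. -/
lemma incenter_eq_and_inradius_eq {T : Affine.Triangle ℝ Plane} {C : Plane} {r : ℝ} (hr : 0 < r)
    {z n : Fin 3 → ℂ} (hT : ∀ i, T.points i = pt C r (z i)) (hn : ∀ i, ‖n i‖ = 1)
    (h1 : ∀ i j, j ≠ i → (conj (n i) * z j).re = 1) (h2 : ∀ i, (conj (n i) * z i).re < 1) :
    T.incenter = C ∧ T.inradius = r := by
  have key : ∀ i, T.signedInfDist i C = r := by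
    intro i
    obtain ⟨j, k, hji, hki, hjk⟩ : ∃ j k : Fin 3, j ≠ i ∧ k ≠ i ∧ j ≠ k := by
      clear hT hn h1 h2
      decide +revert
    -- The altitude and `n i` are both perpendicular to the side through vertices `j` and `k`, so `z
    -- i - f = t * n i`. Since vertex `i` lies on the inner side of that line, `t < 0`, which fixes
    -- the sign of the signed distance.
    set F : Plane := T.altitudeFoot i with hF
    obtain ⟨f, hf⟩ := pt_surjective C hr.ne' F
    have e1 := T.inner_vsub_vsub_altitudeFoot_eq_height_sq hji.symm
    have e2 := T.inner_vsub_vsub_altitudeFoot_eq_height_sq hki.symm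
    have hpos := pow_pos (T.height_pos i) 2
    rw [← hF, ← hf, hT, hT, vsub_eq_sub, vsub_eq_sub, inner_pt_sub] at e1 e2
    rw [← e1] at hpos
    have hzjk : z j ≠ z k := by
      intro h
      exact hjk (T.independent.injective (by rw [hT, hT, h]))
    have a1 := h1 i j hji
    have a2 := h1 i k hki
    have a3 := h2 i
    have hni := mul_conj_of_norm_one (hn i)
    have hni' := congrArg Complex.re hni
    simp only [Complex.mul_re, Complex.conj_re, Complex.conj_im, Complex.sub_re, Complex.sub_im,
      Complex.one_re] at e1 e2 hpos a1 a2 a3 hni'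
    have p1 : (n i).re * ((z j).re - (z k).re) + (n i).im * ((z j).im - (z k).im) = 0 := by
      linear_combination a1 - a2
    have p2 : ((z i).re - f.re) * ((z j).re - (z k).re) +
        ((z i).im - f.im) * ((z j).im - (z k).im) = 0 := by
      refine mul_left_cancel₀ (mul_pos hr hr).ne' ?_
      linear_combination e2 - e1
    have hcross : (n i).re * ((z i).im - f.im) - (n i).im * ((z i).re - f.re) = 0 := by
      by_cases hx : (z j).re - (z k).re = 0
      · have hy : (z j).im - (z k).im ≠ 0 := fun hy =>
          hzjk (Complex.ext (sub_eq_zero.1 hx) (sub_eq_zero.1 hy))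
        refine mul_left_cancel₀ hy ?_
        linear_combination (n i).re * p2 - ((z i).re - f.re) * p1
      · refine mul_left_cancel₀ hx ?_
        linear_combination ((z i).im - f.im) * p1 - (n i).im * p2
    set t : ℝ := (n i).re * ((z i).re - f.re) + (n i).im * ((z i).im - f.im) with ht
    have g1 : (z i).re - f.re = t * (n i).re := by
      linear_combination -((z i).re - f.re) * hni' - (n i).im * hcross
    have g2 : (z i).im - f.im = t * (n i).im := by
      linear_combination -((z i).im - f.im) * hni' + (n i).re * hcross
    have htneg : t < 0 := by
      rw [g1, g2] at hpos
      by_contra! hc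
      have : 0 < r * r * t * ((n i).re * (z i).re - -(n i).im * (z i).im - 1) := by
        refine hpos.trans_eq ?_
        linear_combination -(r * r * t) * a1
      have h0 : 0 ≤ r * r * t := by positivity
      nlinarith
    have hg : T.points i -ᵥ F = (r * t) • (pt 0 1 (n i) - pt 0 1 0) := by
      rw [hT, ← hf]
      ext l
      fin_cases l
      · simp
        linear_combination r * g1
      · simp
        linear_combination r * g2
    have hN : ‖pt 0 1 (n i) - pt 0 1 0‖ = 1 := by
      rw [← dist_eq_norm, dist_pt _ zero_le_one, sub_zero, hn, one_mul]
    have hmem : T.points j ∈ affineSpan ℝ (T.points '' {i}ᶜ) :=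
      subset_affineSpan _ _ ⟨j, hji, rfl⟩
    have hsd : T.signedInfDist i =
        signedDist (T.points i -ᵥ F) (T.points j) := by
      rw [Affine.Simplex.signedInfDist, AffineSubspace.signedInfDist_eq_signedDist_of_mem hmem, hF,
        Affine.Simplex.altitudeFoot, Affine.Simplex.orthogonalProjectionSpan]
      simp only [Affine.Simplex.range_faceOpposite_points]
    rw [hsd, signedDist_apply_apply, hg,
      NormedSpace.normalize_smul_of_neg (mul_neg_of_pos_of_neg hr htneg),
      NormedSpace.normalize_eq_self_of_norm_eq_one hN, hT j, vsub_eq_sub]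
    nth_rewrite 1 [← pt_zero C r]
    rw [inner_neg_left, inner_pt_sub]
    simp only [Complex.mul_re, Complex.conj_re, Complex.conj_im, Complex.sub_re, Complex.sub_im,
      Complex.zero_re, Complex.zero_im]
    linear_combination r * a1
  have hC : C = T.incenter :=
    (T.exists_forall_signedInfDist_eq_iff_eq_incenter
      (by rw [affineSpan_range_eq_top]; trivial)).1 ⟨r, key⟩
  refine ⟨hC.symm, ?_⟩
  rw [← T.signedInfDist_incenter 0, ← hC, key]

/-- Apply the linear form of `n i` to a barycentric relation for `C`: it is 1 at every vertex except
the `i`-th and 0 at `C`. Total weight 1 serves for the incenter, total weight 0 for affine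
independence. -/
lemma weight_mul_re_sub_one {C : Plane} {r : ℝ} (hr : r ≠ 0) {z n : Fin 3 → ℂ}
    (h1 : ∀ i j, j ≠ i → (conj (n i) * z j).re = 1) {w : Fin 3 → ℝ} {s : ℝ} (hw : ∑ i, w i = s)
    (h : ∑ i, w i • pt C r (z i) = s • C) (i : Fin 3) :
    w i * ((conj (n i) * z i).re - 1) = -s := by
  have hC0 := congrArg (fun p : Plane => p 0) h
  have hC1 := congrArg (fun p : Plane => p 1) h
  simp only [Fin.sum_univ_three, PiLp.add_apply, PiLp.smul_apply, pt_apply_zero,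
    pt_apply_one, smul_eq_mul] at hC0 hC1 hw
  have key : ∑ j, w j * (conj (n i) * z j).re = 0 := by
    refine mul_left_cancel₀ hr ?_
    simp only [Fin.sum_univ_three, Complex.mul_re, Complex.conj_re, Complex.conj_im]
    linear_combination (C 0 * (n i).re + C 1 * (n i).im) * (-hw)
      + (n i).re * hC0 + (n i).im * hC1
  rw [Fin.sum_univ_three] at key
  have h1 := h1 i
  fin_cases i <;> simp only [Fin.zero_eta, Fin.mk_one, Fin.reduceFinMk] at *
  · rw [h1 1 (by decide), h1 2 (by decide)] at key
    linarith
  · rw [h1 0 (by decide), h1 2 (by decide)] at key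
    linarith
  · rw [h1 0 (by decide), h1 1 (by decide)] at key
    linarith

lemma exists_normals (T : Affine.Triangle ℝ Plane) :
    ∃ z n : Fin 3 → ℂ, (∀ i, T.points i = pt T.incenter T.inradius (z i)) ∧ (∀ i, ‖n i‖ = 1) ∧
      (∀ i j, j ≠ i → (conj (n i) * z j).re = 1) ∧ (∀ i, (conj (n i) * z i).re < -1) ∧
      Function.Injective n := by
  have hr := T.inradius_pos
  choose z hz using fun i => pt_surjective T.incenter hr.ne' (T.points i)
  choose n hn using fun i => pt_surjective T.incenter hr.ne' (T.touchpoint ∅ i)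
  have hn1 : ∀ i, ‖n i‖ = 1 := by
    intro i
    have h := T.dist_incenter i
    nth_rewrite 1 [← pt_zero T.incenter T.inradius] at h
    rw [← hn i, dist_pt _ hr.le] at h
    simpa [hr.ne'] using h
  have h1 : ∀ i j, j ≠ i → (conj (n i) * z j).re = 1 := by
    intro i j hij
    have hj : T.points j ∈ affineSpan ℝ (Set.range (T.faceOpposite i).points) := by
      rw [T.range_faceOpposite_points]
      exact subset_affineSpan _ _ ⟨j, hij, rfl⟩
    have h := (T.isTangentAt_insphere_touchpoint i).inner_right_eq_zero_of_mem hj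
    rw [T.insphere_center, vsub_eq_sub, vsub_eq_sub] at h
    nth_rewrite 1 [← pt_zero T.incenter T.inradius] at h
    rw [← hn i, ← hz j, inner_pt_sub] at h
    have h' := (mul_eq_zero.1 h).resolve_left (mul_pos hr hr).ne'
    have e := congrArg Complex.re (mul_conj_of_norm_one (hn1 i))
    simp only [Complex.mul_re, Complex.conj_re, Complex.conj_im, Complex.sub_re, Complex.sub_im,
      Complex.one_re, sub_zero] at h' e ⊢
    linarith
  refine ⟨z, n, fun i => (hz i).symm, hn1, h1, fun i => ?_, fun i j h => ?_⟩
  -- The barycentric weight `w` of the incenter lies in `(0, 1/2)`, and the form at the opposite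
  -- vertex is `1 - 1/w`.
  · have hw := T.sum_excenterWeights_eq_one_iff.2 T.excenterExists_empty
    have hC := T.incenter_eq_affineCombination
    rw [Finset.affineCombination_eq_linear_combination _ _ _ hw] at hC
    have hpos := T.excenterWeights_empty_pos i
    have hlt := T.excenterWeights_empty_lt_inv_two i
    have e := weight_mul_re_sub_one hr.ne' h1 (w := T.excenterWeights ∅) (s := 1) hw
      (C := T.incenter) (by rw [one_smul]; simp_rw [hz]; exact hC.symm) i
    norm_num at hlt
    by_contra! hc
    nlinarith
  · exact T.touchpoint_empty_injective (by rw [← hn, ← hn, h])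

lemma affineIndependent_of_normals {C : Plane} {r : ℝ} (hr : 0 < r)
    {z n : Fin 3 → ℂ} (h1 : ∀ i j, j ≠ i → (conj (n i) * z j).re = 1)
    (h2 : ∀ i, (conj (n i) * z i).re < 1) :
    AffineIndependent ℝ (fun i => pt C r (z i)) := by
  rw [affineIndependent_iff_of_fintype]
  intro w hw h i
  rw [Finset.weightedVSub_eq_linear_combination _ hw] at h
  have e := weight_mul_re_sub_one hr.ne' h1 (C := C) (s := 0) hw (by rw [h, zero_smul]) i
  rw [neg_zero] at e
  exact (mul_eq_zero.1 e).resolve_right (sub_ne_zero.2 (h2 i).ne)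

/-! ### Contact triangles -/

/-- The triangle whose sides touch the circle with center `C` and radius `r` at the points with
complex coordinates `u`, `v`, `w`. -/
structure HasContact (T : Affine.Triangle ℝ Plane) (C : Plane) (r : ℝ) (u v w : ℂ) : Prop where
  norm_u : ‖u‖ = 1
  norm_v : ‖v‖ = 1
  norm_w : ‖w‖ = 1
  norm_sum : ‖u + v + w‖ < 1
  point_zero : T.points 0 = pt C r (2 * (v * w) / (v + w))
  point_one : T.points 1 = pt C r (2 * (u * w) / (u + w))
  point_two : T.points 2 = pt C r (2 * (u * v) / (u + v))

lemma conj_tangent_intersection {v w : ℂ} (hv : ‖v‖ = 1) (hw : ‖w‖ = 1) (h : v + w ≠ 0) :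
    conj (2 * (v * w) / (v + w)) = 2 / (v + w) := by
  have h' : conj v + conj w ≠ 0 := by
    rw [← map_add]; exact (map_ne_zero _).2 h
  simp only [map_mul, map_div₀, map_add, map_ofNat]
  rw [div_eq_div_iff h' h]
  linear_combination 2 * conj w * mul_conj_of_norm_one hv + 2 * conj v * mul_conj_of_norm_one hw

lemma re_conj_mul_tangent_intersection {v w : ℂ} (hv : ‖v‖ = 1) (hw : ‖w‖ = 1) (h : v + w ≠ 0) :
    (conj v * (2 * (v * w) / (v + w))).re = 1 := by
  have : ((conj v * (2 * (v * w) / (v + w))).re : ℂ) = 1 := by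
    rw [Complex.re_eq_add_conj, map_mul, conj_tangent_intersection hv hw h, Complex.conj_conj]
    field_simp
    linear_combination w * mul_conj_of_norm_one hv
  exact_mod_cast this

/-- Eliminate `conj z` from the tangent equations `conj a * z + a * conj z = 2` at `a = v` and `a =
w`; antipodal contact points would have parallel tangents. -/
lemma eq_tangent_intersection {v w z : ℂ} (hv : ‖v‖ = 1) (hw : ‖w‖ = 1) (hvw : v ≠ w)
    (h1 : (conj v * z).re = 1) (h2 : (conj w * z).re = 1) :
    v + w ≠ 0 ∧ z = 2 * (v * w) / (v + w) := by
  have h : v + w ≠ 0 := by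
    intro h
    rw [eq_neg_of_add_eq_zero_left h] at h1
    simp at h1 h2
    linarith
  refine ⟨h, ?_⟩
  have hv1 := mul_conj_of_norm_one hv
  have hw1 := mul_conj_of_norm_one hw
  have e : ∀ a : ℂ, (conj a * z).re = 1 → conj a * z + a * conj z = 2 := by
    intro a ha
    have := Complex.add_conj (conj a * z)
    rw [ha] at this
    simpa using this
  rw [eq_div_iff h]
  refine mul_left_cancel₀ (sub_ne_zero.2 hvw) ?_
  linear_combination v ^ 2 * w * e w h2 - w ^ 2 * v * e v h1 + z * w ^ 2 * hv1 - z * v ^ 2 * hw1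

/-- The sign of the support function at the opposite vertex, in terms of the contact points. -/
lemma re_conj_mul_opposite {u v w : ℂ} (hu : ‖u‖ = 1) (hv : ‖v‖ = 1) (hw : ‖w‖ = 1)
    (h : v + w ≠ 0) :
    ((conj u * (2 * (v * w) / (v + w))).re + 1) * ‖v + w‖ ^ 2 = ‖u + v + w‖ ^ 2 - 1 := by
  have h1 : (conj u * (2 * (v * w) / (v + w))).re = (conj u * (v * w) + u) / (v + w) := by
    rw [Complex.re_eq_add_conj, map_mul, conj_tangent_intersection hv hw h, Complex.conj_conj]
    field_simp
  have h2 : (((conj u * (2 * (v * w) / (v + w))).re + 1) * ‖v + w‖ ^ 2 : ℂ) =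
      ‖u + v + w‖ ^ 2 - 1 := by
    rw [h1, ← Complex.mul_conj', ← Complex.mul_conj']
    simp only [map_add]
    field_simp
    linear_combination w * conj u * mul_conj_of_norm_one hv +
      v * conj u * mul_conj_of_norm_one hw - mul_conj_of_norm_one hu
  exact_mod_cast h2

lemma exists_hasContact (T : Affine.Triangle ℝ Plane) :
    ∃ u v w, HasContact T T.incenter T.inradius u v w := by
  obtain ⟨z, n, hz, hn, h1, h2, h3⟩ := exists_normals T
  have a0 := eq_tangent_intersection (hn 1) (hn 2) (h3.ne (by decide)) (h1 1 0 (by decide))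
    (h1 2 0 (by decide))
  have a1 := eq_tangent_intersection (hn 0) (hn 2) (h3.ne (by decide)) (h1 0 1 (by decide))
    (h1 2 1 (by decide))
  have a2 := eq_tangent_intersection (hn 0) (hn 1) (h3.ne (by decide)) (h1 0 2 (by decide))
    (h1 1 2 (by decide))
  refine ⟨n 0, n 1, n 2, hn 0, hn 1, hn 2, ?_, ?_, ?_, ?_⟩
  -- The opposite vertex lies beyond the parallel tangent (value below -1), which is equivalent to
  -- `|u + v + w| < 1`.
  · have h := re_conj_mul_opposite (hn 0) (hn 1) (hn 2) a0.1
    rw [← a0.2] at h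
    have hp : 0 < ‖n 1 + n 2‖ ^ 2 := pow_pos (norm_pos_iff.2 a0.1) 2
    have := h2 0
    by_contra! hc
    nlinarith
  · rw [hz, a0.2]
  · rw [hz, a1.2]
  · rw [hz, a2.2]

lemma normals_of_norm_sum_lt {u v w : ℂ} (hu : ‖u‖ = 1) (hv : ‖v‖ = 1) (hw : ‖w‖ = 1)
    (h : ‖u + v + w‖ < 1) {z n : Fin 3 → ℂ}
    (hz : z = ![2 * (v * w) / (v + w), 2 * (u * w) / (u + w), 2 * (u * v) / (u + v)])
    (hn : n = ![u, v, w]) :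
    (∀ i, ‖n i‖ = 1) ∧ (∀ i j, j ≠ i → (conj (n i) * z j).re = 1) ∧
      (∀ i, (conj (n i) * z i).re < 1) := by
  have h0 : ∀ {a b c : ℂ}, ‖a‖ = 1 → ‖b‖ = 1 → ‖c‖ = 1 → ‖a + b + c‖ < 1 →
      (conj a * (2 * (b * c) / (b + c))).re < 1 := by
    intro a b c ha hb hc h
    have hne := sum_ne_zero_of_norm_sum_lt ha h
    have e := re_conj_mul_opposite ha hb hc hne
    have hp : 0 < ‖b + c‖ ^ 2 := pow_pos (norm_pos_iff.2 hne) 2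
    have := norm_nonneg (a + b + c)
    by_contra! hcon
    nlinarith
  have hvw := sum_ne_zero_of_norm_sum_lt hu h
  have huw := sum_ne_zero_of_norm_sum_lt (u := v) (v := u) hv (by rwa [add_comm v u])
  have huv := sum_ne_zero_of_norm_sum_lt (u := w) (v := u) (w := v) hw
    (by rwa [show w + u + v = u + v + w by ring])
  have b0 := h0 hu hv hw h
  have b1 := h0 hv hu hw (by rwa [add_comm v u])
  have b2 := h0 hw hu hv (by rwa [show w + u + v = u + v + w by ring])
  have c1 := re_conj_mul_tangent_intersection hv hw hvw
  have c2 := re_conj_mul_tangent_intersection hw hv (by rwa [add_comm])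
  have c3 := re_conj_mul_tangent_intersection hu hw huw
  have c4 := re_conj_mul_tangent_intersection hw hu (by rwa [add_comm])
  have c5 := re_conj_mul_tangent_intersection hu hv huv
  have c6 := re_conj_mul_tangent_intersection hv hu (by rwa [add_comm])
  rw [mul_comm w, add_comm w] at c2 c4
  rw [mul_comm v u, add_comm v u] at c6
  subst hz hn
  refine ⟨fun i => ?_, fun i j hij => ?_, fun i => ?_⟩
  · fin_cases i <;> assumption
  · fin_cases i <;> fin_cases j <;> first | exact absurd rfl hij | assumption
  · fin_cases i <;> assumption

lemma HasContact.incenter_eq {T : Affine.Triangle ℝ Plane} {C : Plane} {r : ℝ} {u v w : ℂ}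
    (h : HasContact T C r u v w) (hr : 0 < r) : T.incenter = C ∧ T.inradius = r := by
  obtain ⟨h1, h2, h3⟩ := normals_of_norm_sum_lt h.norm_u h.norm_v h.norm_w h.norm_sum rfl rfl
  refine incenter_eq_and_inradius_eq hr (fun i => ?_) h1 h2 h3
  fin_cases i
  exacts [h.point_zero, h.point_one, h.point_two]

lemma exists_triangle_hasContact (C : Plane) {r : ℝ} (hr : 0 < r) {u v w : ℂ} (hu : ‖u‖ = 1)
    (hv : ‖v‖ = 1) (hw : ‖w‖ = 1) (h : ‖u + v + w‖ < 1) :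
    ∃ T, HasContact T C r u v w := by
  obtain ⟨-, h2, h3⟩ := normals_of_norm_sum_lt hu hv hw h rfl rfl
  exact ⟨⟨_, affineIndependent_of_normals (C := C) hr h2 h3⟩, hu, hv, hw, h, rfl, rfl, rfl⟩

end PonceletX36

end

noncomputable section

namespace PonceletX36

open ComplexConjugate

/-! ### The circumcenter and `X₃₆` -/

/-- By `norm_sum_sq_sub_one` the difference equals `2vw/(uK)` with `K = |σ|² - 1`; its norm does not
depend on the vertex. -/
lemma tangent_intersection_sub_circumcenter {u v w : ℂ} (hu : ‖u‖ = 1) (hv : ‖v‖ = 1)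
    (hw : ‖w‖ = 1) (h : ‖u + v + w‖ < 1) :
    ‖2 * (v * w) / (v + w) - ((2 / (‖u + v + w‖ ^ 2 - 1) : ℝ) : ℂ) * (u + v + w)‖ =
      2 / (1 - ‖u + v + w‖ ^ 2) := by
  have hK : ‖u + v + w‖ ^ 2 - 1 < 0 := by nlinarith [norm_nonneg (u + v + w)]
  have hvw := sum_ne_zero_of_norm_sum_lt hu h
  have hu0 := ne_zero_of_norm_one hu
  have hP := norm_sum_sq_sub_one hu hv hw
  set K := ‖u + v + w‖ ^ 2 - 1 with hKdef
  have hK0 : (K : ℂ) ≠ 0 := by exact_mod_cast hK.ne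
  have e : 2 * (v * w) / (v + w) - ((2 / K : ℝ) : ℂ) * (u + v + w) = 2 * (v * w) / (u * K) := by
    push_cast
    field_simp
    linear_combination hP
  rw [e, norm_div, norm_mul, norm_mul, norm_mul, hu, hv, hw, Complex.norm_real, Real.norm_eq_abs,
    abs_of_neg hK, hKdef, neg_sub, Complex.norm_ofNat, mul_one, mul_one, one_mul]

lemma HasContact.circumcenter_eq {T : Affine.Triangle ℝ Plane} {C : Plane} {r : ℝ} {u v w : ℂ}
    (h : HasContact T C r u v w) (hr : 0 < r) :
    T.circumcenter = pt C r (((2 / (‖u + v + w‖ ^ 2 - 1) : ℝ) : ℂ) * (u + v + w)) ∧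
      T.circumradius = r * (2 / (1 - ‖u + v + w‖ ^ 2)) := by
  have hd : ∀ i, dist (T.points i)
      (pt C r (((2 / (‖u + v + w‖ ^ 2 - 1) : ℝ) : ℂ) * (u + v + w))) =
        r * (2 / (1 - ‖u + v + w‖ ^ 2)) := by
    intro i
    have hs := h.norm_sum
    fin_cases i
    · simp only [Fin.zero_eta, h.point_zero, dist_pt _ hr.le]
      rw [tangent_intersection_sub_circumcenter h.norm_u h.norm_v h.norm_w hs]
    · simp only [Fin.mk_one, h.point_one, dist_pt _ hr.le]
      rw [add_comm u v] at hs ⊢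
      rw [tangent_intersection_sub_circumcenter h.norm_v h.norm_u h.norm_w hs]
    · simp only [Fin.reduceFinMk, h.point_two, dist_pt _ hr.le]
      rw [show u + v + w = w + u + v by ring] at hs ⊢
      rw [tangent_intersection_sub_circumcenter h.norm_w h.norm_u h.norm_v hs]
  have htop : ∀ p, p ∈ affineSpan ℝ (Set.range T.points) := fun p => by
    rw [affineSpan_range_eq_top]; trivial
  exact ⟨(T.eq_circumcenter_of_dist_eq (htop _) hd).symm,
    (T.eq_circumradius_of_dist_eq (htop _) hd).symm⟩

lemma HasContact.incenter_eq_circumcenter_iff {T : Affine.Triangle ℝ Plane} {C : Plane} {r : ℝ}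
    {u v w : ℂ} (h : HasContact T C r u v w) (hr : 0 < r) :
    T.incenter = T.circumcenter ↔ u + v + w = 0 := by
  have hK : ‖u + v + w‖ ^ 2 - 1 < 0 := by nlinarith [norm_nonneg (u + v + w), h.norm_sum]
  have h2 : ((2 / (‖u + v + w‖ ^ 2 - 1) : ℝ) : ℂ) ≠ 0 := by
    exact_mod_cast div_ne_zero two_ne_zero hK.ne
  rw [(h.incenter_eq hr).1, (h.circumcenter_eq hr).1]
  nth_rewrite 1 [← pt_zero C r]
  rw [(pt_injective C hr).eq_iff, eq_comm, mul_eq_zero, or_iff_right h2]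

lemma HasContact.X36_eq {T : Affine.Triangle ℝ Plane} {C : Plane} {r : ℝ} {u v w : ℂ}
    (h : HasContact T C r u v w) (hr : 0 < r) (h0 : u + v + w ≠ 0) :
    X36 T = pt C r (((2 / ‖u + v + w‖ ^ 2 : ℝ) : ℂ) * (u + v + w)) := by
  have hK : ‖u + v + w‖ ^ 2 - 1 < 0 := by nlinarith [norm_nonneg (u + v + w), h.norm_sum]
  have hn : 0 < ‖u + v + w‖ := norm_pos_iff.2 h0
  obtain ⟨hO, hR⟩ := h.circumcenter_eq hr
  rw [X36, EuclideanGeometry.inversion, hO, hR, (h.incenter_eq hr).1]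
  nth_rewrite 1 [← pt_zero C r]
  rw [dist_pt C hr.le, zero_sub, norm_neg, norm_mul, Complex.norm_real, Real.norm_eq_abs, abs_div,
    abs_of_neg hK, abs_two]
  generalize u + v + w = σ at *
  have hK' : ‖σ‖ ^ 2 - 1 ≠ 0 := hK.ne
  have hK'' : 1 - ‖σ‖ ^ 2 ≠ 0 := by rw [← neg_sub]; exact neg_ne_zero.2 hK'
  -- The circumradius is `1/|σ|` times the distance from circumcenter `O` to incenter, so the
  -- inverse point is `(1 - 1/|σ|²) O`.
  have e : (r * (2 / (1 - ‖σ‖ ^ 2)) / (r * (2 / -(‖σ‖ ^ 2 - 1) * ‖σ‖))) ^ 2 = 1 / ‖σ‖ ^ 2 := by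
    rw [neg_sub]
    field_simp
  rw [e]
  have e2 : 1 / ‖σ‖ ^ 2 * -(2 / (‖σ‖ ^ 2 - 1)) + 2 / (‖σ‖ ^ 2 - 1) = 2 / ‖σ‖ ^ 2 := by
    field_simp
    ring
  ext i
  fin_cases i
  · simp only [Fin.zero_eta, vadd_eq_add, vsub_eq_sub, PiLp.add_apply, PiLp.smul_apply,
      PiLp.sub_apply, smul_eq_mul, pt_apply_zero, Complex.re_ofReal_mul]
    linear_combination r * σ.re * e2
  · simp only [Fin.mk_one, vadd_eq_add, vsub_eq_sub, PiLp.add_apply, PiLp.smul_apply,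
      PiLp.sub_apply, smul_eq_mul, pt_apply_one, Complex.im_ofReal_mul]
    linear_combination r * σ.im * e2

/-! ### Vertices on the ellipse -/

/-- Minus the value of the equation of the ellipse at `C`; positive inside the ellipse. -/
def deficit (a b : ℝ) (C : Plane) : ℝ := 1 - ((C 0 / a) ^ 2 + (C 1 / b) ^ 2)

/-- The center of the circle described by the sum of the contact points. -/
def shift (a b : ℝ) (C : Plane) (r : ℝ) : ℂ :=
  ⟨2 * r * C 0 / a ^ 2 / deficit a b C, 2 * r * C 1 / b ^ 2 / deficit a b C⟩

/-- The radius of the circle described by the sum of the contact points. -/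
def spread (a b : ℝ) (C : Plane) (r : ℝ) : ℝ := r ^ 2 * (1 / b ^ 2 - 1 / a ^ 2) / deficit a b C

/-- The mixed coefficient in the condition for the intersection point of two tangents of the
incircle to lie on the ellipse. -/
def mixedCoeff (a b : ℝ) (C : Plane) (r : ℝ) : ℝ :=
  -(2 * r ^ 2 * (1 / a ^ 2 + 1 / b ^ 2)) / deficit a b C

lemma pt_mem_axisEllipse_iff {a b : ℝ} {C : Plane} {r : ℝ} (hD : deficit a b C ≠ 0) {v w : ℂ}
    (hv : ‖v‖ = 1) (hw : ‖w‖ = 1) (h : v + w ≠ 0) :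
    pt C r (2 * (v * w) / (v + w)) ∈ axisEllipse a b ↔
      tangentConic (shift a b C r) (spread a b C r) (mixedCoeff a b C r) v w = 0 := by
  have hc := conj_tangent_intersection hv hw h
  set z := 2 * (v * w) / (v + w) with hz
  have hzp : z * (v + w) = 2 * (v * w) := div_mul_cancel₀ _ h
  have hcp : conj z * (v + w) = 2 := by rw [hc, div_mul_cancel₀ _ h]
  have hre : (z.re : ℂ) * (v + w) = v * w + 1 := by
    rw [Complex.re_eq_add_conj]; linear_combination (hzp + hcp) / 2
  have him : (z.im : ℂ) * (v + w) = -Complex.I * (v * w - 1) := by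
    have := Complex.sub_conj z
    push_cast at this
    linear_combination (-Complex.I / 2) * (hzp - hcp - (v + w) * this) +
      (z.im : ℂ) * (v + w) * Complex.I_sq
  have hDc : (deficit a b C : ℂ) ≠ 0 := by exact_mod_cast hD
  have hs : (deficit a b C : ℂ) * shift a b C r =
      2 * r * (C 0 * (1 / (a : ℂ) ^ 2) + Complex.I * C 1 * (1 / (b : ℂ) ^ 2)) := by
    rw [← Complex.re_add_im (shift a b C r)]
    simp only [shift]
    push_cast
    field_simp
  have hs' : (deficit a b C : ℂ) * conj (shift a b C r) =
      2 * r * (C 0 * (1 / (a : ℂ) ^ 2) - Complex.I * C 1 * (1 / (b : ℂ) ^ 2)) := by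
    have := congrArg conj hs
    simpa [sub_eq_add_neg, map_ofNat] using this
  have hm : (deficit a b C : ℂ) * spread a b C r =
      r ^ 2 * (1 / (b : ℂ) ^ 2 - 1 / (a : ℂ) ^ 2) := by
    simp only [spread]
    push_cast
    field_simp
  have hk : (deficit a b C : ℂ) * mixedCoeff a b C r =
      -(2 * r ^ 2 * (1 / (a : ℂ) ^ 2 + 1 / (b : ℂ) ^ 2)) := by
    simp only [mixedCoeff]
    push_cast
    field_simp
  have hDdef : (deficit a b C : ℂ) =
      1 - ((C 0 : ℂ) ^ 2 * (1 / (a : ℂ) ^ 2) + (C 1 : ℂ) ^ 2 * (1 / (b : ℂ) ^ 2)) := by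
    simp only [deficit]
    push_cast
    ring
  -- Insert `z.re = (vw+1)/(v+w)` and `z.im = -i(vw-1)/(v+w)` in the equation of the ellipse and
  -- clear `(v+w)²`. Dividing by the deficit normalizes the coefficient of `(v+w)²` to 1.
  have key : ((((C 0 + r * z.re) / a) ^ 2 + ((C 1 + r * z.im) / b) ^ 2 - 1 : ℝ) : ℂ) *
      (v + w) ^ 2 = -deficit a b C *
        tangentConic (shift a b C r) (spread a b C r) (mixedCoeff a b C r) v w := by
    unfold tangentConic
    push_cast
    linear_combination
      1 / (a : ℂ) ^ 2 * r * (2 * C 0 * (v + w) + r * (z.re * (v + w) + v * w + 1)) * hre +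
      1 / (b : ℂ) ^ 2 * r * (2 * C 1 * (v + w) + r * (z.im * (v + w) - Complex.I * (v * w - 1))) *
        him + 1 / (b : ℂ) ^ 2 * r ^ 2 * (v * w - 1) ^ 2 * Complex.I_sq + (v + w) ^ 2 * hDdef -
      (v + w) * hs - (v + w) * (v * w) * hs' + (1 + (v * w) ^ 2) * hm + v * w * hk
  simp only [axisEllipse, Set.mem_ofPred_eq, pt_apply_zero, pt_apply_one]
  rw [← sub_eq_zero, ← Complex.ofReal_inj, Complex.ofReal_zero]
  constructor
  · intro h0
    rw [h0, zero_mul, eq_comm, mul_eq_zero, neg_eq_zero] at key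
    exact key.resolve_left hDc
  · intro h0
    rw [h0, mul_zero, mul_eq_zero] at key
    exact key.resolve_right (pow_ne_zero 2 h)

lemma mem_ponceletTriangles_iff {a b : ℝ} {C : Plane} {r : ℝ} (hD : deficit a b C ≠ 0)
    {T : Affine.Triangle ℝ Plane} :
    T ∈ ponceletTriangles a b C r ↔ 0 < r ∧ ∃ u v w, HasContact T C r u v w ∧
      u + v + w = shift a b C r + spread a b C r * (u * v * w) ∧
      ‖shift a b C r‖ ^ 2 = 1 + spread a b C r ^ 2 + mixedCoeff a b C r := by
  have main : ∀ {u v w}, HasContact T C r u v w → ((∀ i, T.points i ∈ axisEllipse a b) ↔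
      u + v + w = shift a b C r + spread a b C r * (u * v * w) ∧
      ‖shift a b C r‖ ^ 2 = 1 + spread a b C r ^ 2 + mixedCoeff a b C r) := by
    intro u v w h
    have hs := h.norm_sum
    have hs1 : ‖v + u + w‖ < 1 := by rwa [add_comm v u]
    have hs2 : ‖w + u + v‖ < 1 := by rwa [show w + u + v = u + v + w by ring]
    rw [← tangentConic_eq_zero_iff h.norm_u h.norm_v h.norm_w
      (ne_of_norm_sum_lt h.norm_w h.norm_u hs2) (ne_of_norm_sum_lt h.norm_v h.norm_u hs1)
      (ne_of_norm_sum_lt h.norm_u h.norm_v hs),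
      ← pt_mem_axisEllipse_iff hD h.norm_v h.norm_w (sum_ne_zero_of_norm_sum_lt h.norm_u hs),
      ← pt_mem_axisEllipse_iff hD h.norm_u h.norm_w (sum_ne_zero_of_norm_sum_lt h.norm_v hs1),
      ← pt_mem_axisEllipse_iff hD h.norm_u h.norm_v (sum_ne_zero_of_norm_sum_lt h.norm_w hs2),
      ← h.point_zero, ← h.point_one, ← h.point_two]
    exact Fin.forall_fin_succ.trans (and_congr_right fun _ => Fin.forall_fin_two)
  constructor
  · rintro ⟨hE, rfl, rfl⟩
    obtain ⟨u, v, w, h⟩ := exists_hasContact T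
    exact ⟨T.inradius_pos, u, v, w, h, (main h).1 hE⟩
  · rintro ⟨hr, u, v, w, h, hE⟩
    exact ⟨(main h).2 hE, h.incenter_eq hr⟩

end PonceletX36

end

noncomputable section

namespace PonceletX36

open ComplexConjugate

/-! ### The closure condition -/

/-- The sum of the reciprocals of the squared semiaxes, doubled. -/
def axisSum (a b : ℝ) : ℝ := 2 * (1 / a ^ 2 + 1 / b ^ 2)

/-- The difference of the reciprocals of the squared semiaxes. -/
def axisDiff (a b : ℝ) : ℝ := 1 / b ^ 2 - 1 / a ^ 2

/-- The squared gradient of the equation of the ellipse at `C`, divided by `deficit a b C`. -/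
def gradQuot (a b : ℝ) (C : Plane) : ℝ :=
  4 * (C 0 ^ 2 / a ^ 4 + C 1 ^ 2 / b ^ 4) / deficit a b C

lemma axisDiff_pos {a b : ℝ} (hb : 0 < b) (hab : b < a) : 0 < axisDiff a b := by
  have h : b ^ 2 < a ^ 2 := by nlinarith
  exact sub_pos.2 (one_div_lt_one_div_of_lt (by positivity) h)

lemma two_mul_axisDiff_lt_axisSum {a b : ℝ} (ha : 0 < a) : 2 * axisDiff a b < axisSum a b := by
  have : 0 < 1 / a ^ 2 := by positivity
  unfold axisDiff axisSum
  linarith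

/-- With `ρ = r²/deficit`, `M = axisDiff`, `A = axisSum` and `G = gradQuot`, the closure condition
becomes the quadratic `1 + ρ²M² - ρ(A + G) = 0`. -/
lemma spread_eq (a b : ℝ) (C : Plane) (r : ℝ) :
    spread a b C r = r ^ 2 / deficit a b C * axisDiff a b := by
  unfold spread axisDiff; ring

lemma mixedCoeff_eq (a b : ℝ) (C : Plane) (r : ℝ) :
    mixedCoeff a b C r = -(r ^ 2 / deficit a b C * axisSum a b) := by
  unfold mixedCoeff axisSum; ring

lemma norm_shift_sq (a b : ℝ) (C : Plane) (r : ℝ) :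
    ‖shift a b C r‖ ^ 2 = r ^ 2 / deficit a b C * gradQuot a b C := by
  rw [← Complex.normSq_eq_norm_sq, Complex.normSq_apply]
  unfold shift gradQuot
  ring

lemma gradQuot_nonneg {a b : ℝ} {C : Plane} (hD : 0 < deficit a b C) : 0 ≤ gradQuot a b C := by
  unfold gradQuot; positivity

/-- Closure and `A > 2M` give `|s|² < (1 - m)²`. Hence the whole `σ`-circle lies in the open unit
disk. -/
lemma norm_shift_add_spread_lt_one {a b : ℝ} (hb : 0 < b) (hab : b < a) {C : Plane}
    (hD : 0 < deficit a b C) {r : ℝ} (hr : 0 < r)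
    (hcl : ‖shift a b C r‖ ^ 2 = 1 + spread a b C r ^ 2 + mixedCoeff a b C r)
    (hm : spread a b C r < 1) : ‖shift a b C r‖ + spread a b C r < 1 := by
  have hρ : 0 < r ^ 2 / deficit a b C := by positivity
  have h := mul_lt_mul_of_pos_left (two_mul_axisDiff_lt_axisSum (b := b) (hb.trans hab)) hρ
  have h1 := spread_eq a b C r
  have h2 := mixedCoeff_eq a b C r
  have : ‖shift a b C r‖ < 1 - spread a b C r :=
    lt_of_pow_lt_pow_left₀ 2 (by linarith) (by nlinarith)
  linarith

/-- If `m ≥ 1`, the same estimate gives `|s| < m - 1`, while a point of the `σ`-circle in the unit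
disk forces `|s| > m - 1`. This discards the larger root of the closure quadratic. -/
lemma spread_lt_one {a b : ℝ} (hb : 0 < b) (hab : b < a) {C : Plane}
    (hD : 0 < deficit a b C) {r : ℝ} (hr : 0 < r)
    (hcl : ‖shift a b C r‖ ^ 2 = 1 + spread a b C r ^ 2 + mixedCoeff a b C r) {l : ℂ}
    (hl : ‖l‖ = 1) (h : ‖shift a b C r + spread a b C r * l‖ < 1) : spread a b C r < 1 := by
  have hρ : 0 < r ^ 2 / deficit a b C := by positivity
  have h0 := mul_lt_mul_of_pos_left (two_mul_axisDiff_lt_axisSum (b := b) (hb.trans hab)) hρ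
  have h1 := spread_eq a b C r
  have h2 := mixedCoeff_eq a b C r
  have hpos : 0 < spread a b C r := by rw [h1]; exact mul_pos hρ (axisDiff_pos hb hab)
  by_contra! hm
  have e : ‖(spread a b C r : ℂ) * l‖ ≤
      ‖shift a b C r + spread a b C r * l‖ + ‖shift a b C r‖ := by
    have := norm_sub_le (shift a b C r + spread a b C r * l) (shift a b C r)
    rwa [add_sub_cancel_left] at this
  rw [norm_mul, hl, mul_one, Complex.norm_real, Real.norm_of_nonneg hpos.le] at e
  have := norm_nonneg (shift a b C r)
  nlinarith

lemma exists_radius {a b : ℝ} (hb : 0 < b) (hab : b < a) {C : Plane} (hD : 0 < deficit a b C) :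
    ∃ r : ℝ, 0 < r ∧ ‖shift a b C r‖ ^ 2 = 1 + spread a b C r ^ 2 + mixedCoeff a b C r ∧
      spread a b C r < 1 := by
  have hM := axisDiff_pos hb hab
  have hA := two_mul_axisDiff_lt_axisSum (b := b) (hb.trans hab)
  have hG := gradQuot_nonneg hD
  set M := axisDiff a b
  set A := axisSum a b
  set G := gradQuot a b C
  have hf : ContinuousOn (fun x : ℝ => 1 + x ^ 2 * M ^ 2 - x * (A + G)) (Set.Icc 0 (1 / M)) := by
    fun_prop
  -- The closure quadratic is 1 at `ρ = 0` and negative at `ρ = 1/M`, where `m` would be 1; its root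
  -- in between has `m < 1`.
  have hend : 1 + (1 / M) ^ 2 * M ^ 2 - 1 / M * (A + G) < 0 := by
    have e : 1 + (1 / M) ^ 2 * M ^ 2 - 1 / M * (A + G) = (2 * M - A - G) / M := by
      field_simp; ring
    rw [e]
    exact div_neg_of_neg_of_pos (by linarith) hM
  obtain ⟨x, ⟨hx0, hx1⟩, hx⟩ := intermediate_value_Icc' (by positivity) hf
    (show (0 : ℝ) ∈ _ from ⟨hend.le, by norm_num⟩)
  simp only at hx
  have hx0' : 0 < x := by
    refine hx0.lt_of_ne ?_
    rintro rfl
    norm_num at hx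
  have hx1' : x < 1 / M := by
    refine hx1.lt_of_ne ?_
    rintro rfl
    exact hend.ne hx
  have hρ : √(x * deficit a b C) ^ 2 / deficit a b C = x := by
    rw [Real.sq_sqrt (by positivity)]; field_simp
  refine ⟨√(x * deficit a b C), by positivity, ?_, ?_⟩
  · rw [norm_shift_sq, spread_eq, mixedCoeff_eq, hρ]
    linear_combination -hx
  · rw [spread_eq, hρ]
    rwa [lt_div_iff₀ hM] at hx1'

lemma exists_mem_ponceletTriangles {a b : ℝ} (hb : 0 < b) (hab : b < a) {C : Plane}
    (hD : 0 < deficit a b C) {r : ℝ} (hr : 0 < r)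
    (hcl : ‖shift a b C r‖ ^ 2 = 1 + spread a b C r ^ 2 + mixedCoeff a b C r)
    (hm : spread a b C r < 1) {l : ℂ} (hl : ‖l‖ = 1) :
    ∃ T ∈ ponceletTriangles a b C r, ∃ u v w, HasContact T C r u v w ∧
      u + v + w = shift a b C r + spread a b C r * l := by
  have hpos : 0 < spread a b C r := by
    rw [spread_eq]; exact mul_pos (by positivity) (axisDiff_pos hb hab)
  have hlt : ‖shift a b C r + spread a b C r * l‖ < 1 := by
    refine (norm_add_le _ _).trans_lt ?_
    rw [norm_mul, hl, mul_one, Complex.norm_real, Real.norm_of_nonneg hpos.le]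
    exact norm_shift_add_spread_lt_one hb hab hD hr hcl hm
  obtain ⟨u, v, w, hu, hv, hw, hs, hp⟩ := exists_unit_triple hlt hl
  obtain ⟨T, hT⟩ := exists_triangle_hasContact C hr hu hv hw (by rwa [hs])
  exact ⟨T, (mem_ponceletTriangles_iff hD.ne').2 ⟨hr, u, v, w, hT, by rw [hs, hp], hcl⟩,
    u, v, w, hT, hs⟩

lemma exists_nonempty_ponceletTriangles {a b : ℝ} (hb : 0 < b) (hab : b < a) {C : Plane}
    (hD : 0 < deficit a b C) : ∃ r : ℝ, (ponceletTriangles a b C r).Nonempty := by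
  obtain ⟨r, hr, hcl, hm⟩ := exists_radius hb hab hD
  obtain ⟨T, hT, -⟩ := exists_mem_ponceletTriangles hb hab hD hr hcl hm norm_one
  exact ⟨r, T, hT⟩

lemma closure_of_nonempty {a b : ℝ} (hb : 0 < b) (hab : b < a) {C : Plane}
    (hD : 0 < deficit a b C) {r : ℝ} (h : (ponceletTriangles a b C r).Nonempty) :
    0 < r ∧ ‖shift a b C r‖ ^ 2 = 1 + spread a b C r ^ 2 + mixedCoeff a b C r ∧
      spread a b C r < 1 := by
  obtain ⟨T, hT⟩ := h
  obtain ⟨hr, u, v, w, hc, hs, hcl⟩ := (mem_ponceletTriangles_iff hD.ne').1 hT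
  refine ⟨hr, hcl, spread_lt_one hb hab hD hr hcl (l := u * v * w) ?_ ?_⟩
  · simp [hc.norm_u, hc.norm_v, hc.norm_w]
  · rw [← hs]; exact hc.norm_sum

/-! ### The locus -/

/-- Inversion of a circle in the unit circle: the inverses of the nonzero points of the circle with
center `s` and radius `m`, scaled by `2`. -/
lemma exists_inverse_iff {s q : ℂ} {m : ℝ} (hm : 0 < m) :
    (∃ l : ℂ, ‖l‖ = 1 ∧ s + m * l ≠ 0 ∧ ((2 / ‖s + m * l‖ ^ 2 : ℝ) : ℂ) * (s + m * l) = q) ↔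
      4 - 4 * (q.re * s.re + q.im * s.im) + (‖s‖ ^ 2 - m ^ 2) * ‖q‖ ^ 2 = 0 := by
  have hcirc : ∀ t : ℂ, (∃ l : ℂ, ‖l‖ = 1 ∧ s + m * l = t) ↔
      ‖t‖ ^ 2 - 2 * (t.re * s.re + t.im * s.im) + ‖s‖ ^ 2 = m ^ 2 := by
    intro t
    have e : ‖t‖ ^ 2 - 2 * (t.re * s.re + t.im * s.im) + ‖s‖ ^ 2 = ‖t - s‖ ^ 2 := by
      simp only [← Complex.normSq_eq_norm_sq, Complex.normSq_apply, Complex.sub_re, Complex.sub_im]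
      ring
    have hmc : (m : ℂ) ≠ 0 := by exact_mod_cast hm.ne'
    rw [e, sq_eq_sq₀ (norm_nonneg _) hm.le]
    constructor
    · rintro ⟨l, hl, rfl⟩
      rw [add_sub_cancel_left, norm_mul, hl, mul_one, Complex.norm_real, Real.norm_of_nonneg hm.le]
    · intro h
      refine ⟨(t - s) / m, ?_, ?_⟩
      · rw [norm_div, h, Complex.norm_real, Real.norm_of_nonneg hm.le, div_self hm.ne']
      · rw [mul_div_cancel₀ _ hmc, add_sub_cancel]
  constructor
  · rintro ⟨l, hl, h0, rfl⟩
    have h := (hcirc _).1 ⟨l, hl, rfl⟩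
    generalize s + m * l = t at *
    have ht : 0 < ‖t‖ := norm_pos_iff.2 h0
    rw [Complex.re_ofReal_mul, Complex.im_ofReal_mul, norm_mul, Complex.norm_real,
      Real.norm_of_nonneg (by positivity)]
    field_simp
    linear_combination 4 * h
  · intro h
    have hq : q ≠ 0 := by
      rintro rfl
      norm_num at h
    have hq' : 0 < ‖q‖ := norm_pos_iff.2 hq
    have hn : ‖((2 / ‖q‖ ^ 2 : ℝ) : ℂ) * q‖ = 2 / ‖q‖ := by
      rw [norm_mul, Complex.norm_real, Real.norm_of_nonneg (by positivity)]
      field_simp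
    -- The map `q ↦ 2q/|q|²` is an involution, so the preimage of `q` is its own image.
    obtain ⟨l, hl, hlt⟩ := (hcirc (((2 / ‖q‖ ^ 2 : ℝ) : ℂ) * q)).2 (by
      rw [hn, Complex.re_ofReal_mul, Complex.im_ofReal_mul]
      field_simp
      linear_combination h)
    refine ⟨l, hl, ?_, ?_⟩
    · rw [hlt]
      exact mul_ne_zero (by exact_mod_cast (by positivity : (2 / ‖q‖ ^ 2 : ℝ) ≠ 0)) hq
    · rw [hlt, hn, ← mul_assoc, ← Complex.ofReal_mul]
      have : 2 / (2 / ‖q‖) ^ 2 * (2 / ‖q‖ ^ 2) = 1 := by field_simp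
      rw [this, Complex.ofReal_one, one_mul]

lemma pt_mem_locusX36_iff {a b : ℝ} (hb : 0 < b) (hab : b < a) {C : Plane}
    (hD : 0 < deficit a b C) {r : ℝ} (h : (ponceletTriangles a b C r).Nonempty) {q : ℂ} :
    pt C r q ∈ locusX36 a b C r ↔
      4 - 4 * (q.re * (shift a b C r).re + q.im * (shift a b C r).im) +
        (‖shift a b C r‖ ^ 2 - spread a b C r ^ 2) * ‖q‖ ^ 2 = 0 := by
  obtain ⟨hr, hcl, hm⟩ := closure_of_nonempty hb hab hD h
  have hpos : 0 < spread a b C r := by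
    rw [spread_eq]; exact mul_pos (by positivity) (axisDiff_pos hb hab)
  rw [← exists_inverse_iff hpos]
  constructor
  · rintro ⟨T, hT, hne, hX⟩
    obtain ⟨-, u, v, w, hc, hs, -⟩ := (mem_ponceletTriangles_iff hD.ne').1 hT
    have h0 : u + v + w ≠ 0 := fun h0 => hne ((hc.incenter_eq_circumcenter_iff hr).2 h0)
    rw [hc.X36_eq hr h0] at hX
    refine ⟨u * v * w, by simp [hc.norm_u, hc.norm_v, hc.norm_w], by rwa [← hs], ?_⟩
    rw [← hs]
    exact pt_injective C hr hX
  · rintro ⟨l, hl, h0, rfl⟩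
    obtain ⟨T, hT, u, v, w, hc, hs⟩ := exists_mem_ponceletTriangles hb hab hD hr hcl hm hl
    rw [← hs] at h0 ⊢
    exact ⟨T, hT, fun he => h0 ((hc.incenter_eq_circumcenter_iff hr).1 he), hc.X36_eq hr h0⟩

lemma locusX36_eq_sphere {a b : ℝ} (hb : 0 < b) (hab : b < a) {C : Plane}
    (hD : 0 < deficit a b C) {r : ℝ} (h : (ponceletTriangles a b C r).Nonempty)
    (hK : ‖shift a b C r‖ ^ 2 - spread a b C r ^ 2 ≠ 0) :
    ∃ (O : Plane) (ρ : ℝ), 0 < ρ ∧ locusX36 a b C r = Metric.sphere O ρ := by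
  obtain ⟨hr, -, -⟩ := closure_of_nonempty hb hab hD h
  have hpos : 0 < spread a b C r := by
    rw [spread_eq]; exact mul_pos (by positivity) (axisDiff_pos hb hab)
  set K := ‖shift a b C r‖ ^ 2 - spread a b C r ^ 2 with hKdef
  -- Center and radius come from completing the square after division by `K`.
  refine ⟨pt C r (((2 / K : ℝ) : ℂ) * shift a b C r), r * (2 * spread a b C r / |K|),
    by positivity, ?_⟩
  ext P
  obtain ⟨q, rfl⟩ := pt_surjective C hr.ne' P
  rw [pt_mem_locusX36_iff hb hab hD h, Metric.mem_sphere, dist_pt C hr.le,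
    mul_right_inj' hr.ne', ← sq_eq_sq₀ (norm_nonneg _) (by positivity), div_pow, sq_abs, ← hKdef]
  have e : ‖q - ((2 / K : ℝ) : ℂ) * shift a b C r‖ ^ 2 - (2 * spread a b C r) ^ 2 / K ^ 2 =
      (4 - 4 * (q.re * (shift a b C r).re + q.im * (shift a b C r).im) + K * ‖q‖ ^ 2) / K := by
    rw [eq_div_iff hK]
    have e1 : ‖q - ((2 / K : ℝ) : ℂ) * shift a b C r‖ ^ 2 = ‖q‖ ^ 2 -
        4 / K * (q.re * (shift a b C r).re + q.im * (shift a b C r).im) +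
        4 / K ^ 2 * ‖shift a b C r‖ ^ 2 := by
      simp only [← Complex.normSq_eq_norm_sq, Complex.normSq_apply, Complex.sub_re, Complex.sub_im,
        Complex.re_ofReal_mul, Complex.im_ofReal_mul]
      ring_nf
    rw [e1]
    field_simp
    linear_combination -4 * hKdef
  rw [← sub_eq_zero (a := ‖_‖ ^ 2), e, div_eq_zero_iff, or_iff_left hK]

/-- The centroid ellipse in terms of the coefficients of the closure condition. -/
lemma mem_centroidEllipse_iff {a b : ℝ} (hb : 0 < b) (hab : b < a) {C : Plane} :
    C ∈ axisEllipse (a * (a ^ 2 - b ^ 2) / (a ^ 2 + 3 * b ^ 2))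
        (b * (a ^ 2 - b ^ 2) / (3 * a ^ 2 + b ^ 2)) ↔
      0 < deficit a b C ∧ axisSum a b * gradQuot a b C = axisDiff a b ^ 2 := by
  have ha := hb.trans hab
  have hc : 0 < a ^ 2 - b ^ 2 := by nlinarith
  have hM := axisDiff_pos hb hab
  have e : (C 0 / (a * (a ^ 2 - b ^ 2) / (a ^ 2 + 3 * b ^ 2))) ^ 2 +
      (C 1 / (b * (a ^ 2 - b ^ 2) / (3 * a ^ 2 + b ^ 2))) ^ 2 - 1 =
      (axisSum a b * (4 * (C 0 ^ 2 / a ^ 4 + C 1 ^ 2 / b ^ 4)) -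
        axisDiff a b ^ 2 * deficit a b C) * (a ^ 4 * b ^ 4 / (a ^ 2 - b ^ 2) ^ 2) := by
    unfold axisSum axisDiff deficit
    field_simp
    ring
  have hG : 0 < deficit a b C →
      gradQuot a b C * deficit a b C = 4 * (C 0 ^ 2 / a ^ 4 + C 1 ^ 2 / b ^ 4) :=
    fun hD => div_mul_cancel₀ _ hD.ne'
  have hfac : a ^ 4 * b ^ 4 / (a ^ 2 - b ^ 2) ^ 2 ≠ 0 := by positivity
  rw [axisEllipse, Set.mem_ofPred_eq, ← sub_eq_zero, e, mul_eq_zero, or_iff_left hfac]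
  constructor
  · intro h
    have hA : 0 < axisSum a b := by unfold axisSum; positivity
    have h0 : 0 ≤ axisSum a b * (4 * (C 0 ^ 2 / a ^ 4 + C 1 ^ 2 / b ^ 4)) := by positivity
    have hD : 0 < deficit a b C := by
      -- A nonpositive deficit would force the gradient term to vanish, hence `C = 0`, where the
      -- deficit is 1.
      by_contra! hD
      have h1 : axisSum a b * (4 * (C 0 ^ 2 / a ^ 4 + C 1 ^ 2 / b ^ 4)) ≤ 0 := by nlinarith
      have h2 : C 0 ^ 2 / a ^ 4 + C 1 ^ 2 / b ^ 4 ≤ 0 := by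
        by_contra! h3
        have : 0 < axisSum a b * (4 * (C 0 ^ 2 / a ^ 4 + C 1 ^ 2 / b ^ 4)) := by positivity
        linarith
      have p0 : 0 ≤ C 0 ^ 2 / a ^ 4 := by positivity
      have p1 : 0 ≤ C 1 ^ 2 / b ^ 4 := by positivity
      have q0 : C 0 ^ 2 / a ^ 4 = 0 := by linarith
      have q1 : C 1 ^ 2 / b ^ 4 = 0 := by linarith
      have r0 : C 0 = 0 := by simpa [ha.ne'] using q0
      have r1 : C 1 = 0 := by simpa [hb.ne'] using q1
      simp only [deficit, r0, r1] at hD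
      norm_num at hD
    refine ⟨hD, ?_⟩
    refine mul_right_cancel₀ hD.ne' ?_
    linear_combination h + axisSum a b * hG hD
  · rintro ⟨hD, h⟩
    linear_combination deficit a b C * h - axisSum a b * hG hD

/-- If `|s| = m`, closure gives `ρA = 1`, and `ρ` can be eliminated from `G = ρM²`. Conversely, `AG
= M²` factors the closure condition as `(1 - ρA)(A - ρM²) = 0`; the second factor is nonzero since
`ρM < 1` and `A > 2M`. -/
lemma norm_shift_sq_eq_spread_sq_iff {a b : ℝ} (hb : 0 < b) (hab : b < a) {C : Plane}
    (hD : 0 < deficit a b C) {r : ℝ} (hr : 0 < r)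
    (hcl : ‖shift a b C r‖ ^ 2 = 1 + spread a b C r ^ 2 + mixedCoeff a b C r)
    (hm : spread a b C r < 1) :
    ‖shift a b C r‖ ^ 2 - spread a b C r ^ 2 = 0 ↔
      axisSum a b * gradQuot a b C = axisDiff a b ^ 2 := by
  have hρ : 0 < r ^ 2 / deficit a b C := by positivity
  have hM := axisDiff_pos hb hab
  have hA := two_mul_axisDiff_lt_axisSum (b := b) (hb.trans hab)
  rw [norm_shift_sq, spread_eq, mixedCoeff_eq] at hcl
  rw [spread_eq] at hm
  rw [norm_shift_sq, spread_eq]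
  generalize r ^ 2 / deficit a b C = ρ at *
  generalize axisDiff a b = M at *
  generalize axisSum a b = A at *
  generalize gradQuot a b C = G at *
  constructor
  · intro h
    have h1 : ρ * A = 1 := by linarith
    have h2 : G = ρ * M ^ 2 := mul_left_cancel₀ hρ.ne' (by linear_combination h)
    rw [h2]
    linear_combination M ^ 2 * h1
  · intro h
    have h1 : (1 - ρ * A) * (A - ρ * M ^ 2) = 0 := by linear_combination ρ * h - A * hcl
    rcases mul_eq_zero.1 h1 with h2 | h2
    · linarith
    · nlinarith

end PonceletX36

end

noncomputable section

namespace PonceletX36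

open ComplexConjugate

/-! ### Equilateral triangles -/

lemma tangent_intersection_of_sum_eq_zero {u v w : ℂ} (hu : ‖u‖ = 1) (hv : ‖v‖ = 1)
    (hw : ‖w‖ = 1) (h : u + v + w = 0) : 2 * (v * w) / (v + w) = -2 * u := by
  have hvw : v + w = -u := by linear_combination h
  have hu0 := ne_zero_of_norm_one hu
  have h2 := conj_sum_mul_prod hu hv hw
  rw [h, map_zero, mul_zero] at h2
  rw [hvw, div_eq_iff (neg_ne_zero.2 hu0)]
  linear_combination -2 * h2 - 2 * u * h

lemma norm_sub_sq_of_sum_eq_zero {u v w : ℂ} (hu : ‖u‖ = 1) (hv : ‖v‖ = 1) (hw : ‖w‖ = 1)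
    (h : u + v + w = 0) : ‖u - v‖ ^ 2 = 3 := by
  have h1 := parallelogram_law_with_norm ℝ u v
  have h2 : ‖u + v‖ = 1 := by
    rw [eq_neg_of_add_eq_zero_left h, norm_neg, hw]
  rw [h2, hu, hv] at h1
  linarith

lemma HasContact.points_of_sum_eq_zero {T : Affine.Triangle ℝ Plane} {C : Plane} {r : ℝ}
    {u v w : ℂ} (h : HasContact T C r u v w) (h0 : u + v + w = 0) :
    T.points 0 = pt C r (-2 * u) ∧ T.points 1 = pt C r (-2 * v) ∧ T.points 2 = pt C r (-2 * w) := by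
  refine ⟨?_, ?_, ?_⟩
  · rw [h.point_zero, tangent_intersection_of_sum_eq_zero h.norm_u h.norm_v h.norm_w h0]
  · rw [h.point_one, tangent_intersection_of_sum_eq_zero h.norm_v h.norm_u h.norm_w
      (by linear_combination h0)]
  · rw [h.point_two, tangent_intersection_of_sum_eq_zero h.norm_w h.norm_u h.norm_v
      (by linear_combination h0)]

lemma centroid_eq_iff_coord (T : Affine.Triangle ℝ Plane) (C : Plane) :
    T.centroid = C ↔ ∀ i, T.points 0 i + T.points 1 i + T.points 2 i = 3 * C i := by
  rw [eq_comm, T.eq_centroid_iff_sum_vsub_eq_zero]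
  have e : ∑ i, (T.points i -ᵥ C) = (T.points 0 -ᵥ C) + (T.points 1 -ᵥ C) + (T.points 2 -ᵥ C) :=
    Fin.sum_univ_three (fun i : Fin 3 => T.points i -ᵥ C)
  rw [e]
  constructor
  · intro h i
    have := congrArg (fun p : Plane => p i) h
    simp only [vsub_eq_sub, PiLp.add_apply, PiLp.sub_apply, PiLp.zero_apply] at this
    linarith
  · intro h
    ext i
    simp only [vsub_eq_sub, PiLp.add_apply, PiLp.sub_apply, PiLp.zero_apply]
    linarith [h i]

lemma HasContact.equilateral {T : Affine.Triangle ℝ Plane} {C : Plane} {r : ℝ}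
    {u v w : ℂ} (h : HasContact T C r u v w) (hr : 0 < r) (h0 : u + v + w = 0) :
    T.Equilateral ∧ T.centroid = C := by
  obtain ⟨p0, p1, p2⟩ := h.points_of_sum_eq_zero h0
  have hn : ∀ {x y z : ℂ}, ‖x‖ = 1 → ‖y‖ = 1 → ‖z‖ = 1 → x + y + z = 0 →
      ‖-2 * x - -2 * y‖ = 2 * √3 := by
    intro x y z hx hy hz hs
    rw [← mul_sub, norm_mul, norm_neg, Complex.norm_ofNat,
      ← norm_sub_sq_of_sum_eq_zero hx hy hz hs, Real.sqrt_sq (norm_nonneg _)]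
  constructor
  · rw [Affine.Triangle.equilateral_iff_dist_01_eq_02_and_dist_01_eq_12, p0, p1, p2,
      dist_pt _ hr.le, dist_pt _ hr.le, dist_pt _ hr.le,
      hn h.norm_u h.norm_v h.norm_w h0,
      hn h.norm_u h.norm_w h.norm_v (by linear_combination h0),
      hn h.norm_v h.norm_w h.norm_u (by linear_combination h0)]
    exact ⟨rfl, rfl⟩
  · rw [centroid_eq_iff_coord, p0, p1, p2]
    have e0 := congrArg Complex.re h0
    have e1 := congrArg Complex.im h0
    simp only [Complex.add_re, Complex.add_im, Complex.zero_re, Complex.zero_im] at e0 e1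
    intro i
    fin_cases i
    · simp
      linear_combination (-2 * r) * e0
    · simp
      linear_combination (-2 * r) * e1

/-- With the centroid as origin, equal sides force vertices of equal norm; the contact points are
the directions opposite to the vertices, and the inradius is half that norm. -/
lemma exists_hasContact_of_equilateral {T : Affine.Triangle ℝ Plane} (hT : T.Equilateral) :
    ∃ r u v w, 0 < r ∧ HasContact T T.centroid r u v w ∧ u + v + w = 0 := by
  choose z hz using fun i => pt_surjective T.centroid one_ne_zero (T.points i)
  rw [Affine.Triangle.equilateral_iff_dist_01_eq_02_and_dist_01_eq_12] at hT
  have hc := (centroid_eq_iff_coord T _).1 rfl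
  have hne : T.points 0 ≠ T.points 1 := T.independent.injective.ne (by decide)
  rw [← hz 0, ← hz 1, ← hz 2, dist_pt _ zero_le_one, dist_pt _ zero_le_one,
    dist_pt _ zero_le_one] at hT
  rw [← hz 0, ← hz 1] at hne
  simp only [← hz] at hc
  have c0 := hc 0
  have c1 := hc 1
  simp only [pt_apply_zero, pt_apply_one, one_mul] at c0 c1
  have p0 := hz 0
  have p1 := hz 1
  have p2 := hz 2
  generalize z 0 = x at *
  generalize z 1 = y at *
  generalize z 2 = t at *
  have hsum : x + y + t = 0 := by
    apply Complex.ext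
    · simp only [Complex.add_re, Complex.zero_re]; linarith
    · simp only [Complex.add_im, Complex.zero_im]; linarith
  have s0 := congrArg Complex.re hsum
  have s1 := congrArg Complex.im hsum
  have d1 := congrArg (· ^ 2) hT.1
  have d2 := congrArg (· ^ 2) hT.2
  simp only [one_mul, ← Complex.normSq_eq_norm_sq, Complex.normSq_apply, Complex.sub_re,
    Complex.sub_im, Complex.add_re, Complex.add_im, Complex.zero_re, Complex.zero_im]
    at d1 d2 s0 s1
  have t0 : t.re = -x.re - y.re := by linarith
  have t1 : t.im = -x.im - y.im := by linarith
  rw [t0, t1] at d1 d2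
  have hxy : ‖x‖ = ‖y‖ := by
    rw [← sq_eq_sq₀ (norm_nonneg _) (norm_nonneg _), ← Complex.normSq_eq_norm_sq,
      ← Complex.normSq_eq_norm_sq, Complex.normSq_apply, Complex.normSq_apply]
    linear_combination (d2 - d1) / 3
  have hxt : ‖x‖ = ‖t‖ := by
    rw [← sq_eq_sq₀ (norm_nonneg _) (norm_nonneg _), ← Complex.normSq_eq_norm_sq,
      ← Complex.normSq_eq_norm_sq, Complex.normSq_apply, Complex.normSq_apply]
    rw [t0, t1]
    linear_combination d2 / 3
  have hx : 0 < ‖x‖ := by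
    rw [norm_pos_iff]
    rintro rfl
    rw [norm_zero, eq_comm, norm_eq_zero] at hxy
    exact hne (by rw [hxy])
  have hxc : (‖x‖ : ℂ) ≠ 0 := by exact_mod_cast hx.ne'
  have hn : ∀ a : ℂ, ‖x‖ = ‖a‖ → ‖-a / ‖x‖‖ = 1 := by
    intro a ha
    rw [norm_div, norm_neg, Complex.norm_real, norm_norm, ← ha, div_self hx.ne']
  have hs : -x / ‖x‖ + -y / ‖x‖ + -t / ‖x‖ = 0 := by
    rw [← add_div, ← add_div]
    simp only [div_eq_zero_iff]
    left
    linear_combination -hsum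
  have hpt : ∀ a : ℂ, pt T.centroid (‖x‖ / 2) (-2 * (-a / ‖x‖)) = pt T.centroid 1 a := by
    intro a
    have e : -2 * (-a / (‖x‖ : ℂ)) = ((2 / ‖x‖ : ℝ) : ℂ) * a := by
      push_cast; ring
    rw [e]
    ext i
    fin_cases i
    · simp only [Fin.zero_eta, pt_apply_zero, Complex.re_ofReal_mul]
      field_simp
    · simp only [Fin.mk_one, pt_apply_one, Complex.im_ofReal_mul]
      field_simp
  have nx := hn x rfl
  have ny := hn y hxy
  have nt := hn t hxt
  refine ⟨‖x‖ / 2, -x / ‖x‖, -y / ‖x‖, -t / ‖x‖, by positivity, ⟨nx, ny, nt, ?_, ?_, ?_, ?_⟩, hs⟩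
  · rw [hs, norm_zero]; exact one_pos
  · rw [tangent_intersection_of_sum_eq_zero nx ny nt hs, hpt, p0]
  · rw [tangent_intersection_of_sum_eq_zero ny nx nt (by linear_combination hs), hpt, p1]
  · rw [tangent_intersection_of_sum_eq_zero nt nx ny (by linear_combination hs), hpt, p2]

/-- Add the equations of the ellipse at the three vertices: the linear terms cancel as `u + v + w =
0`, leaving a positive sum of squares. -/
lemma HasContact.deficit_pos {T : Affine.Triangle ℝ Plane} {a b : ℝ} (ha : 0 < a) (hb : 0 < b)
    {C : Plane} {r : ℝ} {u v w : ℂ} (h : HasContact T C r u v w) (hr : 0 < r) (h0 : u + v + w = 0)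
    (hE : ∀ i, T.points i ∈ axisEllipse a b) : 0 < deficit a b C := by
  obtain ⟨p0, p1, p2⟩ := h.points_of_sum_eq_zero h0
  have e0 := hE 0
  have e1 := hE 1
  have e2 := hE 2
  rw [p0, axisEllipse, Set.mem_ofPred_eq] at e0
  rw [p1, axisEllipse, Set.mem_ofPred_eq] at e1
  rw [p2, axisEllipse, Set.mem_ofPred_eq] at e2
  have s0 := congrArg Complex.re h0
  have s1 := congrArg Complex.im h0
  simp only [pt_apply_zero, pt_apply_one, Complex.mul_re, Complex.mul_im, Complex.neg_re,
    Complex.neg_im, Complex.re_ofNat, Complex.im_ofNat, neg_zero, zero_mul, sub_zero, add_zero,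
    Complex.add_re, Complex.add_im, Complex.zero_re, Complex.zero_im] at e0 e1 e2 s0 s1
  have key : 3 * deficit a b C = 4 * r ^ 2 * ((u.re ^ 2 + v.re ^ 2 + w.re ^ 2) / a ^ 2 +
      (u.im ^ 2 + v.im ^ 2 + w.im ^ 2) / b ^ 2) := by
    unfold deficit
    linear_combination -e0 - e1 - e2 - 4 * r * C 0 / a ^ 2 * s0 - 4 * r * C 1 / b ^ 2 * s1
  have hpos : 0 < u.re ^ 2 / a ^ 2 + u.im ^ 2 / b ^ 2 := by
    by_cases hre : u.re = 0
    · have him : u.im ≠ 0 := fun him =>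
        ne_zero_of_norm_one h.norm_u (Complex.ext hre him)
      positivity
    · positivity
  have hrest : 0 ≤ (v.re ^ 2 + w.re ^ 2) / a ^ 2 + (v.im ^ 2 + w.im ^ 2) / b ^ 2 := by positivity
  have : 0 < 4 * r ^ 2 * ((u.re ^ 2 / a ^ 2 + u.im ^ 2 / b ^ 2) +
      ((v.re ^ 2 + w.re ^ 2) / a ^ 2 + (v.im ^ 2 + w.im ^ 2) / b ^ 2)) := by positivity
  have e : 3 * deficit a b C = 4 * r ^ 2 * ((u.re ^ 2 / a ^ 2 + u.im ^ 2 / b ^ 2) +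
      ((v.re ^ 2 + w.re ^ 2) / a ^ 2 + (v.im ^ 2 + w.im ^ 2) / b ^ 2)) := by
    rw [key]; ring
  linarith

lemma mem_equilateralCentroidLocus_iff {a b : ℝ} (hb : 0 < b) (hab : b < a) {C : Plane} :
    C ∈ equilateralCentroidLocus a b ↔
      0 < deficit a b C ∧ axisSum a b * gradQuot a b C = axisDiff a b ^ 2 := by
  constructor
  · rintro ⟨T, hE, hT, rfl⟩
    obtain ⟨r, u, v, w, hr, hc, h0⟩ := exists_hasContact_of_equilateral hT
    have hD := hc.deficit_pos (hb.trans hab) hb hr h0 hE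
    have hmem : T ∈ ponceletTriangles a b T.centroid r := ⟨hE, hc.incenter_eq hr⟩
    obtain ⟨-, hcl, hm⟩ := closure_of_nonempty hb hab hD ⟨T, hmem⟩
    refine ⟨hD, (norm_shift_sq_eq_spread_sq_iff hb hab hD hr hcl hm).1 ?_⟩
    obtain ⟨-, u', v', w', hc', hs', -⟩ := (mem_ponceletTriangles_iff hD.ne').1 hmem
    rw [(hc'.incenter_eq_circumcenter_iff hr).1
      ((hc.incenter_eq_circumcenter_iff hr).2 h0)] at hs'
    rw [eq_neg_of_add_eq_zero_left hs'.symm, norm_neg, norm_mul, norm_mul, norm_mul, hc'.norm_u,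
      hc'.norm_v, hc'.norm_w, Complex.norm_real, Real.norm_eq_abs, mul_one, mul_one, mul_one,
      sq_abs, sub_self]
  · rintro ⟨hD, h⟩
    obtain ⟨r, hr, hcl, hm⟩ := exists_radius hb hab hD
    have hpos : 0 < spread a b C r := by
      rw [spread_eq]; exact mul_pos (by positivity) (axisDiff_pos hb hab)
    have hK := (norm_shift_sq_eq_spread_sq_iff hb hab hD hr hcl hm).2 h
    have hn : ‖shift a b C r‖ = spread a b C r :=
      (sq_eq_sq₀ (norm_nonneg _) hpos.le).1 (sub_eq_zero.1 hK)
    -- This value of `uvw` makes `σ = s + m·uvw` vanish, so the corresponding member of the family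
    -- is equilateral.
    have hl : ‖-shift a b C r / spread a b C r‖ = 1 := by
      rw [norm_div, norm_neg, hn, Complex.norm_real, Real.norm_of_nonneg hpos.le,
        div_self hpos.ne']
    obtain ⟨T, hT, u, v, w, hc, hs⟩ := exists_mem_ponceletTriangles hb hab hD hr hcl hm hl
    have hsc : (spread a b C r : ℂ) ≠ 0 := by exact_mod_cast hpos.ne'
    rw [mul_div_cancel₀ _ hsc, add_neg_cancel] at hs
    exact ⟨T, hT.1, hc.equilateral hr hs⟩

lemma equilateralCentroidLocus_eq {a b : ℝ} (hb : 0 < b) (hab : b < a) :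
    equilateralCentroidLocus a b =
      axisEllipse (a * (a ^ 2 - b ^ 2) / (a ^ 2 + 3 * b ^ 2))
        (b * (a ^ 2 - b ^ 2) / (3 * a ^ 2 + b ^ 2)) := by
  ext C
  rw [mem_equilateralCentroidLocus_iff hb hab, mem_centroidEllipse_iff hb hab]

lemma locusX36_eq_line {a b : ℝ} (hb : 0 < b) (hab : b < a) {C : Plane}
    (hD : 0 < deficit a b C) {r : ℝ} (h : (ponceletTriangles a b C r).Nonempty)
    (hC : axisSum a b * gradQuot a b C = axisDiff a b ^ 2) :
    locusX36 a b C r =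
      {p : Plane | b ^ 2 * C 0 * p 0 + a ^ 2 * C 1 * p 1 =
        (b ^ 2 * (a ^ 4 + 2 * a ^ 2 * b ^ 2 + 5 * b ^ 4) * C 0 ^ 2 +
          a ^ 2 * (5 * a ^ 4 + 2 * a ^ 2 * b ^ 2 + b ^ 4) * C 1 ^ 2) / (a ^ 2 - b ^ 2) ^ 2} := by
  have ha := hb.trans hab
  have hc : 0 < a ^ 2 - b ^ 2 := by nlinarith
  obtain ⟨hr, hcl, hm⟩ := closure_of_nonempty hb hab hD h
  ext P
  obtain ⟨q, rfl⟩ := pt_surjective C hr.ne' P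
  rw [pt_mem_locusX36_iff hb hab hD h,
    (norm_shift_sq_eq_spread_sq_iff hb hab hD hr hcl hm).2 hC, Set.mem_ofPred_eq, pt_apply_zero,
    pt_apply_one, ← sub_eq_zero (a := b ^ 2 * C 0 * _ + _)]
  have hG : gradQuot a b C * deficit a b C = 4 * (C 0 ^ 2 / a ^ 4 + C 1 ^ 2 / b ^ 4) :=
    div_mul_cancel₀ _ hD.ne'
  have hE : (axisSum a b * (4 * (C 0 ^ 2 / a ^ 4 + C 1 ^ 2 / b ^ 4)) -
        axisDiff a b ^ 2 * deficit a b C) * (a ^ 4 * b ^ 4 / (a ^ 2 - b ^ 2) ^ 2) = 0 := by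
    linear_combination (a ^ 4 * b ^ 4 / (a ^ 2 - b ^ 2) ^ 2) *
      (deficit a b C * hC - axisSum a b * hG)
  have key : b ^ 2 * C 0 * (C 0 + r * q.re) + a ^ 2 * C 1 * (C 1 + r * q.im) -
      (b ^ 2 * (a ^ 4 + 2 * a ^ 2 * b ^ 2 + 5 * b ^ 4) * C 0 ^ 2 +
          a ^ 2 * (5 * a ^ 4 + 2 * a ^ 2 * b ^ 2 + b ^ 4) * C 1 ^ 2) / (a ^ 2 - b ^ 2) ^ 2 =
      -(a ^ 2 * b ^ 2 * deficit a b C / 8) *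
        (4 - 4 * (q.re * (shift a b C r).re + q.im * (shift a b C r).im) + 0 * ‖q‖ ^ 2) := by
    have e1 : a ^ 2 * (deficit a b C * (shift a b C r).re) = 2 * r * C 0 := by
      unfold shift; field_simp
    have e2 : b ^ 2 * (deficit a b C * (shift a b C r).im) = 2 * r * C 1 := by
      unfold shift; field_simp
    -- The constant term of the line agrees with that of the locus only modulo the centroid ellipse
    -- equation `hE`, which is the last summand here.
    have e3 : b ^ 2 * C 0 ^ 2 + a ^ 2 * C 1 ^ 2 -
        (b ^ 2 * (a ^ 4 + 2 * a ^ 2 * b ^ 2 + 5 * b ^ 4) * C 0 ^ 2 +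
          a ^ 2 * (5 * a ^ 4 + 2 * a ^ 2 * b ^ 2 + b ^ 4) * C 1 ^ 2) / (a ^ 2 - b ^ 2) ^ 2 =
        -(a ^ 2 * b ^ 2 / 2) * deficit a b C - a ^ 2 * b ^ 2 / 2 *
          ((axisSum a b * (4 * (C 0 ^ 2 / a ^ 4 + C 1 ^ 2 / b ^ 4)) -
            axisDiff a b ^ 2 * deficit a b C) * (a ^ 4 * b ^ 4 / (a ^ 2 - b ^ 2) ^ 2)) := by
      unfold axisSum axisDiff deficit
      field_simp
      ring
    rw [hE] at e3
    linear_combination e3 - b ^ 2 / 2 * q.re * e1 - a ^ 2 / 2 * q.im * e2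
  have hne : -(a ^ 2 * b ^ 2 * deficit a b C / 8) ≠ 0 := neg_ne_zero.2 (by positivity)
  rw [key, mul_eq_zero, or_iff_right hne]

end PonceletX36

end

theorem mainTheorem6 (a b : ℝ) (hb : 0 < b) (hab : b < a) :
    PonceletX36.equilateralCentroidLocus a b =
        PonceletX36.axisEllipse
          (a * (a ^ 2 - b ^ 2) / (a ^ 2 + 3 * b ^ 2))
          (b * (a ^ 2 - b ^ 2) / (3 * a ^ 2 + b ^ 2)) ∧
      (∀ C ∈ PonceletX36.axisEllipseInterior a b,
        C ∉ PonceletX36.equilateralCentroidLocus a b →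
          (∃ r : ℝ, (PonceletX36.ponceletTriangles a b C r).Nonempty) ∧
          ∀ r : ℝ, (PonceletX36.ponceletTriangles a b C r).Nonempty →
            ∃ (O : PonceletX36.Plane) (ρ : ℝ), 0 < ρ ∧
              PonceletX36.locusX36 a b C r = Metric.sphere O ρ) ∧
      (∀ C ∈ PonceletX36.equilateralCentroidLocus a b,
          (∃ r : ℝ, (PonceletX36.ponceletTriangles a b C r).Nonempty) ∧
          ∀ r : ℝ, (PonceletX36.ponceletTriangles a b C r).Nonempty →
            PonceletX36.locusX36 a b C r =
              {p : PonceletX36.Plane |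
                b ^ 2 * C 0 * p 0 + a ^ 2 * C 1 * p 1 =
                  (b ^ 2 * (a ^ 4 + 2 * a ^ 2 * b ^ 2 + 5 * b ^ 4) * C 0 ^ 2 +
                    a ^ 2 * (5 * a ^ 4 + 2 * a ^ 2 * b ^ 2 + b ^ 4) * C 1 ^ 2) /
                    (a ^ 2 - b ^ 2) ^ 2}) := by
  refine ⟨PonceletX36.equilateralCentroidLocus_eq hb hab, fun C hC hC' => ?_, fun C hC => ?_⟩
  · have hD : 0 < PonceletX36.deficit a b C := sub_pos.2 hC
    refine ⟨PonceletX36.exists_nonempty_ponceletTriangles hb hab hD, fun r h => ?_⟩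
    obtain ⟨hr, hcl, hm⟩ := PonceletX36.closure_of_nonempty hb hab hD h
    exact PonceletX36.locusX36_eq_sphere hb hab hD h fun hK =>
      hC' ((PonceletX36.mem_equilateralCentroidLocus_iff hb hab).2
        ⟨hD, (PonceletX36.norm_shift_sq_eq_spread_sq_iff hb hab hD hr hcl hm).1 hK⟩)
  · obtain ⟨hD, hE⟩ := (PonceletX36.mem_equilateralCentroidLocus_iff hb hab).1 hC
    exact ⟨PonceletX36.exists_nonempty_ponceletTriangles hb hab hD,
      fun r h => PonceletX36.locusX36_eq_line hb hab hD h hE⟩
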